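/- Let $X$ and $Z\subset X$ be complex Hilbert spaces, with $Z$ continuously embedded in $X$, and let $\mathfrak A_0\in\mathcal L(Z,X)$, $\mathfrak B\in\mathcal L(Z,\mathbb C^p)$, $B_d\in\mathcal L(\mathbb C^{n_{1}},X)$, $\mathfrak B_d\in\mathcal L(Z,\mathbb C^{n_{3}})$, $\mathfrak C\in\mathcal L(Z,\mathbb C^p)$ satisfy: (a) the operator $A:=\mathfrak A_0|_{D(A)}$ with domain $D(A)=\ker\mathfrak B\cap\ker\mathfrak B_d$ generates a strongly continuous contraction semigroup on $X$; (b) the operator $\begin{pmatrix}\mathfrak B\\ \mathfrak B_d\end{pmatrix}:Z\to\mathbb C^{p+n_3}$ is surjective; (c) $\operatorname{Re}\langle\mathfrak A_0x,x\rangle_X\le\operatorname{Re}\langle\mathfrak Bx,\mathfrak Cx\rangle_{\mathbb C^p}$ for all $x\in\ker\mathfrak B_d$. Let $X_c=\mathbb C^{n_c}$, $J_c\in\mathbb C^{n_c\times n_c}$ with $J_c^*=-J_c$, $B_c\in\mathbb C^{n_c\times p}$ and $\delta_c>0$. Consider the closed loop consisting of the plant $$\dot x=\mathfrak A_0x+B_dw_1,\quad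 \mathfrak Bx=u+w_2,\quad \mathfrak B_dx=w_3,\quad y=\mathfrak Cx$$ and the controller (with zero feedthrough) $$\dot x_c=J_cx_c+\delta_cB_c(y_{ref}-y),\quad u=\delta_cB_c^*x_c .$$ On the Hilbert space $X_e=X\times X_c$ let $A_e$ be the operator $$A_e\begin{pmatrix}x\\x_c\end{pmatrix}=\begin{pmatrix}\mathfrak A_0x\\-\delta_cB_c\mathfrak Cx+J_cx_c\end{pmatrix},\qquad D(A_e)=\{(x,x_c)\in Z\times X_c:\ \mathfrak Bx=\delta_cB_c^*x_c,\ \mathfrak B_dx=0\}.$$ Then $A_e$ generates a strongly continuous contraction semigroup on $X_e$. Moreover, for all $y_{ref}\in C^2([0,\infty);\mathbb C^p)$, $w_1\in C^2([0,\infty);\mathbb C^{n_1})$, $w_2\in C^2([0,\infty);\mathbb C^{p})$, $w_3\in C^2([0,\infty);\mathbb C^{n_3})$ and all initial states $x_0\in Z$, $x_{c,0}\in X_c$ with $\mathfrak Bx_0=\delta_cB_c^*x_{c,0}+w_2(0)$ and $\mathfrak B_dx_0=w_3(0)$, there are functions $x:[0,\infty)\to Z$ and $x_c:[0,\infty)\to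 X_c$ with $x(0)=x_0$, $x_c(0)=x_{c,0}$ that satisfy the closed-loop equations for every $t\ge0$ (with one-sided derivatives at $t=0$, the derivative of $x$ being taken in $X$) and, for every $T>0$, $$x\in C([0,T];Z)\cap C^1([0,T];X),\qquad x_c\in C^1([0,T];X_c),\qquad e=y-y_{ref}\in C([0,T];\mathbb C^p).$$ -/

import Mathlib

open Set Filter Topology

noncomputable section

namespace BoundaryControl

/-- `ℂⁿ` with its Euclidean inner product. -/
abbrev Cn (n : ℕ) : Type := EuclideanSpace ℂ (Fin n)

section Semigroups

variable {E : Type*} [NormedAddCommGroup E] [NormedSpace ℂ E]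

/-- `T` (restricted to times `t ≥ 0`; values at negative times play no role) is a strongly
continuous semigroup of contractions on `E`. -/
structure IsContractionSemigroup (T : ℝ → E →L[ℂ] E) : Prop where
  map_zero : T 0 = ContinuousLinearMap.id ℂ E
  map_add : ∀ s t : ℝ, 0 ≤ s → 0 ≤ t → T (s + t) = (T s).comp (T t)
  strongly_continuous : ∀ x : E, Tendsto (fun t : ℝ => T t x) (𝓝[>] 0) (𝓝 x)
  norm_le_one : ∀ t : ℝ, 0 ≤ t → ‖T t‖ ≤ 1

/-- The (possibly unbounded) operator `A` is the infinitesimal generator of `T`: `x` lies in the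
domain of `A` exactly when `(T(t)x - x)/t` converges as `t ↓ 0`, and then the limit is `A x`. -/
def IsGenerator (T : ℝ → E →L[ℂ] E) (A : E →ₗ.[ℂ] E) : Prop :=
  ∀ x y : E, (x, y) ∈ A.graph ↔
    Tendsto (fun t : ℝ => t⁻¹ • (T t x - x)) (𝓝[>] 0) (𝓝 y)

/-- `A` generates a strongly continuous contraction semigroup on `E`. -/
def GeneratesContractionSemigroup (A : E →ₗ.[ℂ] E) : Prop :=
  ∃ T : ℝ → E →L[ℂ] E, IsContractionSemigroup T ∧ IsGenerator T A

end Semigroups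

section Restriction

variable {X Z : Type*} [NormedAddCommGroup X] [NormedSpace ℂ X]
  [NormedAddCommGroup Z] [NormedSpace ℂ Z]

/-- Let `Z` be regarded as a subspace of `X` through the injection `ι`. For `𝔄 : Z → X` and a
subspace `V` of `Z`, this is the unbounded operator `𝔄|_V` on `X`, with domain `V` (that is,
`ι(V) ⊆ X`), acting by `ι z ↦ 𝔄 z`. -/
def restrictTo (ι : Z →L[ℂ] X) (hι : Function.Injective ι) (𝔄 : Z →L[ℂ] X)
    (V : Submodule ℂ Z) : X →ₗ.[ℂ] X where
  domain := V.map (ι : Z →ₗ[ℂ] X)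
  toFun := (𝔄 : Z →ₗ[ℂ] X) ∘ₗ V.subtype ∘ₗ
    ((Submodule.equivMapOfInjective (ι : Z →ₗ[ℂ] X) hι V).symm : _ →ₗ[ℂ] V)

theorem mem_graph_restrictTo (ι : Z →L[ℂ] X) (hι : Function.Injective ι) (𝔄 : Z →L[ℂ] X)
    (V : Submodule ℂ Z) (x y : X) :
    (x, y) ∈ (restrictTo ι hι 𝔄 V).graph ↔ ∃ z ∈ V, ι z = x ∧ 𝔄 z = y := by
  rw [LinearPMap.mem_graph_iff]
  constructor
  · rintro ⟨w, hw, hy⟩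
    let v : V := (Submodule.equivMapOfInjective (ι : Z →ₗ[ℂ] X) hι V).symm w
    refine ⟨v, v.2, ?_, hy⟩
    have h := Submodule.map_equivMapOfInjective_symm_apply (ι : Z →ₗ[ℂ] X) hι V w
    exact h.trans hw
  · rintro ⟨z, hz, rfl, rfl⟩
    refine ⟨⟨ι z, Submodule.mem_map_of_mem hz⟩, rfl, ?_⟩
    have h : (Submodule.equivMapOfInjective (ι : Z →ₗ[ℂ] X) hι V).symm
        ⟨ι z, Submodule.mem_map_of_mem hz⟩ = ⟨z, hz⟩ := by
      rw [LinearEquiv.symm_apply_eq]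
      rfl
    change 𝔄 ((Submodule.equivMapOfInjective (ι : Z →ₗ[ℂ] X) hι V).symm
        ⟨ι z, Submodule.mem_map_of_mem hz⟩ : V) = 𝔄 z
    rw [h]

end Restriction

/-- The data of a boundary control and observation system on Hilbert spaces `Z ⊆ X`
(with continuous inclusion `ι`)
`ẋ = 𝔄₀ x + B_d w₁`, `𝔅 x = u + w₂`, `𝔅_d x = w₃`, `y = ℭ x`. -/
structure BCSystem (X Z : Type*) [NormedAddCommGroup X] [InnerProductSpace ℂ X]
    [NormedAddCommGroup Z] [InnerProductSpace ℂ Z] (p n₁ n₃ : ℕ) where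
  ι : Z →L[ℂ] X
  ι_injective : Function.Injective ι
  𝔄₀ : Z →L[ℂ] X
  𝔅 : Z →L[ℂ] Cn p
  B_d : Cn n₁ →L[ℂ] X
  𝔅_d : Z →L[ℂ] Cn n₃
  ℭ : Z →L[ℂ] Cn p

/-- The data of a controller on `ℂⁿ` without feedthrough (`D_c = 0`):
`ẋ_c = J_c x_c + δ_c B_c (y_ref - y)`, `u = δ_c B_c^* x_c`. -/
structure Controller (n p : ℕ) where
  J_c : Cn n →L[ℂ] Cn n
  B_c : Cn p →L[ℂ] Cn n
  δ_c : ℝ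

namespace BCSystem

variable {X Z : Type*} [NormedAddCommGroup X] [InnerProductSpace ℂ X]
  [NormedAddCommGroup Z] [InnerProductSpace ℂ Z] {p n₁ n₃ n : ℕ}

/-- The operator `A = 𝔄₀` restricted to `ker 𝔅 ∩ ker 𝔅_d`. -/
def A (S : BCSystem X Z p n₁ n₃) : X →ₗ.[ℂ] X :=
  restrictTo S.ι S.ι_injective S.𝔄₀
    ((S.𝔅 : Z →ₗ[ℂ] Cn p).ker ⊓ (S.𝔅_d : Z →ₗ[ℂ] Cn n₃).ker)

/-- The standing assumptions on the boundary control system. In `passive` the operator on the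
left is `𝔄`, the restriction of `𝔄₀` to `ker 𝔅_d`, so the inequality is required there. -/
structure StandingAssumption (S : BCSystem X Z p n₁ n₃) : Prop where
  generates : GeneratesContractionSemigroup S.A
  surjective : Function.Surjective (fun z : Z => (S.𝔅 z, S.𝔅_d z))
  passive : ∀ z : Z, S.𝔅_d z = 0 →
    (inner ℂ (S.𝔄₀ z) (S.ι z)).re ≤ (inner ℂ (S.𝔅 z) (S.ℭ z)).re

/-- The inclusion of `Z_e = Z × ℂⁿ` into `X_e = X × ℂⁿ`; both carry the Hilbert product norm. -/
def ιe (S : BCSystem X Z p n₁ n₃) (n : ℕ) :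
    WithLp 2 (Z × Cn n) →L[ℂ] WithLp 2 (X × Cn n) :=
  ((WithLp.prodContinuousLinearEquiv 2 ℂ X (Cn n)).symm : X × Cn n →L[ℂ] WithLp 2 (X × Cn n)) ∘L
    (S.ι.prodMap (ContinuousLinearMap.id ℂ (Cn n))) ∘L
    (WithLp.prodContinuousLinearEquiv 2 ℂ Z (Cn n) : WithLp 2 (Z × Cn n) →L[ℂ] Z × Cn n)

theorem ιe_injective (S : BCSystem X Z p n₁ n₃) (n : ℕ) : Function.Injective (S.ιe n) := by
  have h : Function.Injective (Prod.map S.ι (id : Cn n → Cn n)) :=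
    S.ι_injective.prodMap Function.injective_id
  exact (WithLp.prodContinuousLinearEquiv 2 ℂ X (Cn n)).symm.injective.comp
    (h.comp (WithLp.prodContinuousLinearEquiv 2 ℂ Z (Cn n)).injective)

/-- The operator `𝔄_e (x, x_c) = (𝔄₀ x, -δ_c B_c ℭ x + J_c x_c)`. -/
def 𝔄e (S : BCSystem X Z p n₁ n₃) (K : Controller n p) :
    WithLp 2 (Z × Cn n) →L[ℂ] WithLp 2 (X × Cn n) :=
  ((WithLp.prodContinuousLinearEquiv 2 ℂ X (Cn n)).symm : X × Cn n →L[ℂ] WithLp 2 (X × Cn n)) ∘L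
    ((S.𝔄₀ ∘L ContinuousLinearMap.fst ℂ Z (Cn n)).prod
      (-((K.δ_c : ℂ) • (K.B_c ∘L S.ℭ ∘L ContinuousLinearMap.fst ℂ Z (Cn n))) +
        K.J_c ∘L ContinuousLinearMap.snd ℂ Z (Cn n))) ∘L
    (WithLp.prodContinuousLinearEquiv 2 ℂ Z (Cn n) : WithLp 2 (Z × Cn n) →L[ℂ] Z × Cn n)

/-- The operator `𝔅_e (x, x_c) = (𝔅 x - δ_c B_c^* x_c, 𝔅_d x)`. -/
def 𝔅e (S : BCSystem X Z p n₁ n₃) (K : Controller n p) :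
    WithLp 2 (Z × Cn n) →L[ℂ] Cn p × Cn n₃ :=
  ((S.𝔅 ∘L ContinuousLinearMap.fst ℂ Z (Cn n) -
      (K.δ_c : ℂ) • (K.B_c.adjoint ∘L ContinuousLinearMap.snd ℂ Z (Cn n))).prod
    (S.𝔅_d ∘L ContinuousLinearMap.fst ℂ Z (Cn n))) ∘L
    (WithLp.prodContinuousLinearEquiv 2 ℂ Z (Cn n) : WithLp 2 (Z × Cn n) →L[ℂ] Z × Cn n)

/-- The closed-loop operator `A_e = 𝔄_e` restricted to `ker 𝔅_e`, on `X_e = X × ℂⁿ`. -/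
def Ae (S : BCSystem X Z p n₁ n₃) (K : Controller n p) :
    WithLp 2 (X × Cn n) →ₗ.[ℂ] WithLp 2 (X × Cn n) :=
  restrictTo (S.ιe n) (S.ιe_injective n) (S.𝔄e K)
    (S.𝔅e K : WithLp 2 (Z × Cn n) →ₗ[ℂ] Cn p × Cn n₃).ker

/-- `(x, x_c)` satisfies the closed-loop equations (plant and controller with
`u = δ_c B_c^* x_c` and `y = ℭ x`) at every time `t ≥ 0`; the derivatives are taken in `X` and
`ℂⁿ` and are one-sided at `t = 0`. -/
structure IsClosedLoopState (S : BCSystem X Z p n₁ n₃) (K : Controller n p)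
    (yref : ℝ → Cn p) (w₁ : ℝ → Cn n₁) (w₂ : ℝ → Cn p) (w₃ : ℝ → Cn n₃)
    (x : ℝ → Z) (xc : ℝ → Cn n) : Prop where
  plant : ∀ t, 0 ≤ t →
    HasDerivWithinAt (fun s => S.ι (x s)) (S.𝔄₀ (x t) + S.B_d (w₁ t)) (Ici 0) t
  controller : ∀ t, 0 ≤ t →
    HasDerivWithinAt xc
      (K.J_c (xc t) + (K.δ_c : ℂ) • K.B_c (yref t - S.ℭ (x t))) (Ici 0) t
  input : ∀ t, 0 ≤ t → S.𝔅 (x t) = (K.δ_c : ℂ) • K.B_c.adjoint (xc t) + w₂ t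
  disturbance : ∀ t, 0 ≤ t → S.𝔅_d (x t) = w₃ t

end BCSystem

end BoundaryControl

end

/-! The loop is a power-preserving interconnection of a passive plant with a skew-adjoint
controller. Passivity bounds the plant's power by $\operatorname{Re}\langle\mathfrak Bx,\mathfrak
Cx\rangle$. With $\mathfrak Bx=\delta_cB_c^*x_c$ this is exactly the power that the term
$-\delta_cB_c\mathfrak Cx$ removes from the controller, and $J_c$ contributes none, so $A_e$ is
dissipative (`dissipative`). To solve $(c-A_e)z=y$ for $c>0$, the plant variable is eliminated
through the resolvent of $A$ and an input map. What remains is a square matrix equation, whose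
injectivity is again passivity (`exists_closedLoop_resolvent`). The Lumer-Phillips theorem, derived
here from Hille-Yosida, gives the semigroup.

For the solutions, a bounded right inverse of the boundary operator moves the boundary data into the
right-hand side, leaving $u'=A_eu+F$, $u(0)=0$ with $F\in C^1$; the convolution of the semigroup
with $F$ is then a classical solution (`exists_classical_solution`). Continuity in $Z$, and hence of
the output, holds because $\iota-\mathfrak A$ is an isomorphism from the kernel of the boundary
operator onto $X_e$ (`exists_classical_state`). -/

namespace BoundaryControl

/-! ### The Hille-Yosida theorem via Yosida approximation -/

section HilleYosida

variable {E : Type*} [NormedAddCommGroup E] [NormedSpace ℂ E]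

theorem norm_exp_le_exp_norm [CompleteSpace E] (B : E →L[ℂ] E) :
    ‖NormedSpace.exp B‖ ≤ Real.exp ‖B‖ := by
  have h1 := NormedSpace.exp_series_hasSum_exp' (𝕂 := ℝ) B
  have h2 : HasSum (fun n : ℕ => (n.factorial : ℝ)⁻¹ • ‖B‖ ^ n) (Real.exp ‖B‖) := by
    rw [Real.exp_eq_exp_ℝ]
    exact NormedSpace.exp_series_hasSum_exp' (𝕂 := ℝ) ‖B‖
  have hpow : ∀ n : ℕ, ‖B ^ n‖ ≤ ‖B‖ ^ n := by
    intro n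
    -- On the trivial space the identity has norm 0, so the power 0 needs its own bound.
    rcases Nat.eq_zero_or_pos n with rfl | hn
    · simpa using! ContinuousLinearMap.norm_id_le
    · exact norm_pow_le' B hn
  rw [← h1.tsum_eq]
  refine tsum_of_norm_bounded h2 fun n => ?_
  rw [norm_smul, smul_eq_mul, norm_inv, Real.norm_natCast]
  gcongr
  exact hpow n

theorem exp_add_eq_exp_mul_exp [CompleteSpace E] {P Q : E →L[ℂ] E} (h : Commute P Q) :
    NormedSpace.exp (P + Q) = NormedSpace.exp P * NormedSpace.exp Q :=
  letI : NormedAlgebra ℚ (E →L[ℂ] E) := NormedAlgebra.restrictScalars ℚ ℝ _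
  NormedSpace.exp_add_of_commute h

/-- Yosida approximations have this form. The scalar factor $e^{-c}$ split off from the exponential
compensates $\|e^{cJ}\|\le e^{c}$. -/
theorem norm_exp_smul_sub_one_le_one [CompleteSpace E] {J : E →L[ℂ] E} (hJ : ‖J‖ ≤ 1) {c : ℝ}
    (hc : 0 ≤ c) : ‖NormedSpace.exp (c • (J - 1))‖ ≤ 1 := by
  have h : c • (J - 1) = c • J + algebraMap ℝ (E →L[ℂ] E) (-c) := by
    rw [Algebra.algebraMap_eq_smul_one, smul_sub, neg_smul, sub_eq_add_neg]
  rw [h, exp_add_eq_exp_mul_exp (Algebra.commutes (-c) (c • J)).symm,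
    ← NormedSpace.algebraMap_exp_comm, ← Real.exp_eq_exp_ℝ, ← Algebra.commutes,
    ← Algebra.smul_def, norm_smul, Real.norm_eq_abs, Real.abs_exp]
  calc Real.exp (-c) * ‖NormedSpace.exp (c • J)‖ ≤ Real.exp (-c) * Real.exp c := by
        gcongr
        refine (norm_exp_le_exp_norm _).trans (Real.exp_le_exp.2 ?_)
        rw [norm_smul, Real.norm_eq_abs, abs_of_nonneg hc]
        exact mul_le_of_le_one_right hc hJ
    _ = 1 := by rw [← Real.exp_add, neg_add_cancel, Real.exp_zero]

theorem hasDerivAt_exp_smul_apply [CompleteSpace E] (B : E →L[ℂ] E) (x : E) (t : ℝ) :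
    HasDerivAt (fun s : ℝ => NormedSpace.exp (s • B) x) (NormedSpace.exp (t • B) (B x)) t :=
  (((ContinuousLinearMap.apply ℂ E x).restrictScalars ℝ).hasFDerivAt.comp_hasDerivAt t
    (hasDerivAt_exp_smul_const (𝕂 := ℝ) B t))

/-- The path $s\mapsto e^{(t-s)Q}e^{sP}x$ joins the two vectors, and its derivative
$e^{(t-s)Q}e^{sP}(P-Q)x$ has norm at most $\|Px-Qx\|$. By commutativity the path equals
$e^{tQ}e^{s(P-Q)}x$, which is easier to differentiate. -/
theorem norm_exp_smul_apply_sub_le [CompleteSpace E] {P Q : E →L[ℂ] E} (hPQ : Commute P Q)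
    (hP : ∀ t : ℝ, 0 ≤ t → ‖NormedSpace.exp (t • P)‖ ≤ 1)
    (hQ : ∀ t : ℝ, 0 ≤ t → ‖NormedSpace.exp (t • Q)‖ ≤ 1) {t : ℝ} (ht : 0 ≤ t) (x : E) :
    ‖NormedSpace.exp (t • P) x - NormedSpace.exp (t • Q) x‖ ≤ ‖P x - Q x‖ * t := by
  have hcomm : ∀ s : ℝ, NormedSpace.exp ((t - s) • Q) * NormedSpace.exp (s • P)
      = NormedSpace.exp (t • Q) * NormedSpace.exp (s • (P - Q)) := by
    intro s
    rw [← exp_add_eq_exp_mul_exp, ← exp_add_eq_exp_mul_exp]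
    · congr 1
      module
    · exact (((hPQ.symm).sub_right (Commute.refl Q)).smul_right s).smul_left t
    · exact (hPQ.symm.smul_right s).smul_left (t - s)
  have hd : ∀ s : ℝ, HasDerivAt
      (fun s => NormedSpace.exp (t • Q) (NormedSpace.exp (s • (P - Q)) x))
      (NormedSpace.exp (t • Q) (NormedSpace.exp (s • (P - Q)) ((P - Q) x))) s := fun s =>
    ((NormedSpace.exp (t • Q)).restrictScalars ℝ).hasFDerivAt.comp_hasDerivAt s
      (hasDerivAt_exp_smul_apply (P - Q) x s)
  have hb : ∀ s ∈ Ico (0 : ℝ) t,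
      ‖NormedSpace.exp (t • Q) (NormedSpace.exp (s • (P - Q)) ((P - Q) x))‖ ≤ ‖P x - Q x‖ := by
    intro s hs
    have h : NormedSpace.exp (t • Q) (NormedSpace.exp (s • (P - Q)) ((P - Q) x))
        = (NormedSpace.exp ((t - s) • Q)) (NormedSpace.exp (s • P) (P x - Q x)) :=
      (congrArg (fun M : E →L[ℂ] E => M (P x - Q x)) (hcomm s)).symm
    rw [h]
    refine ((NormedSpace.exp ((t - s) • Q)).le_of_opNorm_le (hQ _ (sub_nonneg.2 hs.2.le)) _).trans ?_
    rw [one_mul]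
    refine ((NormedSpace.exp (s • P)).le_of_opNorm_le (hP _ hs.1) _).trans ?_
    rw [one_mul]
  have := norm_image_sub_le_of_norm_deriv_le_segment'
    (fun s _ => (hd s).hasDerivWithinAt) hb t (right_mem_Icc.2 ht)
  have h0 := congrArg (fun M : E →L[ℂ] E => M x) (hcomm t)
  simp only [sub_self, zero_smul, NormedSpace.exp_zero, one_mul,
    mul_apply_eq_comp] at h0
  rw [← h0] at this
  simpa using! this

/-- A first-order expansion at $t=0$ that survives the limit of the approximations: it is applied
with $y=Ax$, where $\|By\|$ may be unbounded along them, so $y$ is replaced by a nearby $z$ in the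
domain, for which $\|Bz\|$ converges. -/
theorem norm_exp_smul_apply_sub_self_sub_le [CompleteSpace E] {B : E →L[ℂ] E}
    (hB : ∀ t : ℝ, 0 ≤ t → ‖NormedSpace.exp (t • B)‖ ≤ 1) {t : ℝ} (ht : 0 ≤ t) (x y z : E) :
    ‖NormedSpace.exp (t • B) x - x - t • y‖ ≤ (‖B x - y‖ + 2 * ‖y - z‖ + ‖B z‖ * t) * t := by
  have hz : ∀ s : ℝ, 0 ≤ s → ‖NormedSpace.exp (s • B) z - z‖ ≤ ‖B z‖ * s := by
    intro s hs
    have := norm_exp_smul_apply_sub_le (Commute.zero_right B) hB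
      (fun t _ => by simpa using! ContinuousLinearMap.norm_id_le) hs z
    simpa using! this
  have hd : ∀ s : ℝ, HasDerivAt (fun s : ℝ => NormedSpace.exp (s • B) x - s • y)
      (NormedSpace.exp (s • B) (B x) - y) s := fun s =>
    (hasDerivAt_exp_smul_apply B x s).sub (by simpa using (hasDerivAt_id s).smul_const y)
  have hb : ∀ s ∈ Ico (0 : ℝ) t, ‖NormedSpace.exp (s • B) (B x) - y‖ ≤
      ‖B x - y‖ + 2 * ‖y - z‖ + ‖B z‖ * t := by
    intro s hs
    have e : NormedSpace.exp (s • B) (B x) - y = NormedSpace.exp (s • B) (B x - y) +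
        NormedSpace.exp (s • B) (y - z) + (NormedSpace.exp (s • B) z - z) - (y - z) := by
      rw [map_sub, map_sub]
      abel
    have b : ∀ v, ‖NormedSpace.exp (s • B) v‖ ≤ ‖v‖ := fun v => by
      simpa using (NormedSpace.exp (s • B)).le_of_opNorm_le (hB s hs.1) v
    rw [e]
    refine (norm_sub_le _ _).trans ?_
    have h1 := norm_add₃_le (a := NormedSpace.exp (s • B) (B x - y))
      (b := NormedSpace.exp (s • B) (y - z)) (c := NormedSpace.exp (s • B) z - z)
    have h2 := b (B x - y)
    have h3 := b (y - z)
    have h4 := hz s hs.1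
    have h5 : ‖B z‖ * s ≤ ‖B z‖ * t := by gcongr; exact hs.2.le
    linarith
  have := norm_image_sub_le_of_norm_deriv_le_segment'
    (fun s _ => (hd s).hasDerivWithinAt) hb t (right_mem_Icc.2 ht)
  have e : NormedSpace.exp (t • B) x - x - t • y
      = NormedSpace.exp (t • B) x - t • y - x := by abel
  rw [e]
  simpa using this

/-- The Trotter-Kato type limit behind the Hille-Yosida theorem: commuting bounded generators of
contraction semigroups that converge strongly on a dense subspace. -/
theorem exists_contractionSemigroup_of_approx [CompleteSpace E] (A : E →ₗ.[ℂ] E)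
    (hdense : Dense (A.domain : Set E)) (B : ℕ → E →L[ℂ] E) (hcomm : ∀ m n, Commute (B m) (B n))
    (hB : ∀ n, ∀ t : ℝ, 0 ≤ t → ‖NormedSpace.exp (t • B n)‖ ≤ 1)
    (hlim : ∀ x : A.domain, Tendsto (fun n => B n x) atTop (𝓝 (A x))) :
    ∃ T : ℝ → E →L[ℂ] E, IsContractionSemigroup T ∧ ∀ x : A.domain,
      Tendsto (fun t : ℝ => t⁻¹ • (T t x - x)) (𝓝[>] 0) (𝓝 (A x)) := by
  have hcauchy : ∀ t : ℝ, 0 ≤ t → ∀ x : E,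
      CauchySeq (fun n => NormedSpace.exp (t • B n) x) := by
    intro t ht x
    rw [Metric.cauchySeq_iff]
    intro ε hε
    obtain ⟨z, hzD, hz⟩ := hdense.exists_dist_lt x (show 0 < ε / 4 by positivity)
    have hc := (hlim ⟨z, hzD⟩).cauchySeq
    rw [Metric.cauchySeq_iff] at hc
    obtain ⟨N, hN⟩ := hc (ε / 4 / (t + 1)) (by positivity)
    refine ⟨N, fun m hm n hn => ?_⟩
    have b : ∀ k v, ‖NormedSpace.exp (t • B k) v‖ ≤ ‖v‖ := fun k v => by
      simpa using (NormedSpace.exp (t • B k)).le_of_opNorm_le (hB k t ht) v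
    have h1 := norm_exp_smul_apply_sub_le (hcomm m n) (hB m) (hB n) ht z
    have h2 := hN m hm n hn
    rw [dist_eq_norm] at h2 hz ⊢
    have h3 : ‖B m z - B n z‖ * t ≤ ε / 4 := by
      have h2' : ‖B m z - B n z‖ ≤ ε / 4 / (t + 1) := h2.le
      calc ‖B m z - B n z‖ * t ≤ ε / 4 / (t + 1) * (t + 1) := by gcongr; linarith
        _ = ε / 4 := by field_simp
    have e : NormedSpace.exp (t • B m) x - NormedSpace.exp (t • B n) x =
        NormedSpace.exp (t • B m) (x - z) +
        (NormedSpace.exp (t • B m) z - NormedSpace.exp (t • B n) z) -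
        NormedSpace.exp (t • B n) (x - z) := by
      rw [map_sub, map_sub]
      abel
    rw [e]
    have h4 := norm_sub_le (NormedSpace.exp (t • B m) (x - z) +
        (NormedSpace.exp (t • B m) z - NormedSpace.exp (t • B n) z))
        (NormedSpace.exp (t • B n) (x - z))
    have h5 := norm_add_le (NormedSpace.exp (t • B m) (x - z))
        (NormedSpace.exp (t • B m) z - NormedSpace.exp (t • B n) z)
    have h6 := b m (x - z)
    have h7 := b n (x - z)
    linarith
  choose! L hL using fun t ht x => cauchySeq_tendsto_of_complete (hcauchy t ht x)
  have bexp : ∀ (k : ℕ) (t : ℝ) (v : E), 0 ≤ t → ‖NormedSpace.exp (t • B k) v‖ ≤ ‖v‖ := fun k t v ht => by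
    simpa using (NormedSpace.exp (t • B k)).le_of_opNorm_le (hB k t ht) v
  -- The limit is only available for nonnegative times; `max t 0` makes `T` total.
  let T : ℝ → E →L[ℂ] E := fun t => LinearMap.mkContinuous
    { toFun := L (max t 0)
      map_add' := fun x y => tendsto_nhds_unique (hL _ (le_max_right t 0) (x + y))
        (by simpa using (hL _ (le_max_right t 0) x).add (hL _ (le_max_right t 0) y))
      map_smul' := fun c x => tendsto_nhds_unique (hL _ (le_max_right t 0) (c • x))
        (by simpa using (hL _ (le_max_right t 0) x).const_smul c) } 1 (fun x => by
      rw [one_mul]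
      exact le_of_tendsto (hL _ (le_max_right t 0) x).norm
        (Eventually.of_forall fun n => bexp n _ x (le_max_right t 0)))
  have hT : ∀ t, 0 ≤ t → ∀ x,
      Tendsto (fun n => NormedSpace.exp (t • B n) x) atTop (𝓝 (T t x)) := by
    intro t ht x
    change Tendsto _ _ (𝓝 (L (max t 0) x))
    rw [max_eq_left ht]
    exact hL t ht x
  have hT1 : ∀ t, ‖T t‖ ≤ 1 := fun t => LinearMap.mkContinuous_norm_le _ zero_le_one _
  have hTb : ∀ t v, ‖T t v‖ ≤ ‖v‖ := fun t v => by
    simpa using (T t).le_of_opNorm_le (hT1 t) v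
  have key : ∀ (x z : A.domain) (t : ℝ), 0 ≤ t →
      ‖T t x - x - t • A x‖ ≤ (2 * ‖A x - z‖ + ‖A z‖ * t) * t := by
    intro x z t ht
    have h1 : Tendsto (fun n => ‖NormedSpace.exp (t • B n) x - x - t • A x‖) atTop
        (𝓝 ‖T t x - x - t • A x‖) := (((hT t ht x).sub_const _).sub_const _).norm
    have h2 : Tendsto (fun n => (‖B n x - A x‖ + 2 * ‖A x - z‖ + ‖B n z‖ * t) * t) atTop
        (𝓝 ((‖A x - A x‖ + 2 * ‖A x - z‖ + ‖A z‖ * t) * t)) :=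
      (((((hlim x).sub_const _).norm.add_const _).add ((hlim z).norm.mul_const t))).mul_const t
    have := le_of_tendsto_of_tendsto' h1 h2 fun n =>
      norm_exp_smul_apply_sub_self_sub_le (hB n) ht (x : E) (A x) (z : E)
    simpa using this
  have hgen : ∀ x : A.domain,
      Tendsto (fun t : ℝ => t⁻¹ • (T t x - x)) (𝓝[>] 0) (𝓝 (A x)) := by
    intro x
    rw [Metric.tendsto_nhds]
    intro ε hε
    obtain ⟨z, hzD, hz⟩ := hdense.exists_dist_lt (A x) (show 0 < ε / 4 by positivity)
    rw [dist_eq_norm] at hz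
    have hpos : 0 < ε / 2 / (‖A ⟨z, hzD⟩‖ + 1) := by positivity
    filter_upwards [Ioo_mem_nhdsGT hpos] with t ht
    have ht0 := ht.1
    have h := key x ⟨z, hzD⟩ t ht0.le
    have e : t⁻¹ • (T t x - x) - A x = t⁻¹ • (T t x - x - t • A x) := by
      rw [smul_sub t⁻¹ _ (t • A x), smul_smul, inv_mul_cancel₀ ht0.ne', one_smul]
    rw [dist_eq_norm, e, norm_smul, norm_inv, Real.norm_eq_abs, abs_of_pos ht0]
    have h2 : ‖A ⟨z, hzD⟩‖ * t < ε / 2 := by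
      have := (lt_div_iff₀ (by positivity)).1 ht.2
      nlinarith
    calc t⁻¹ * ‖T t x - x - t • A x‖
        ≤ t⁻¹ * ((2 * ‖A x - z‖ + ‖A ⟨z, hzD⟩‖ * t) * t) := by gcongr
      _ = 2 * ‖A x - z‖ + ‖A ⟨z, hzD⟩‖ * t := by field_simp
      _ < ε := by linarith
  refine ⟨T, ⟨?_, ?_, ?_, fun t _ => hT1 t⟩, hgen⟩
  · ext x
    refine tendsto_nhds_unique (hT 0 le_rfl x) ?_
    simp
  · intro s t hs ht
    ext x
    refine tendsto_nhds_unique (hT (s + t) (add_nonneg hs ht) x) ?_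
    have e : ∀ n, NormedSpace.exp ((s + t) • B n) x =
        NormedSpace.exp (s • B n) (NormedSpace.exp (t • B n) x - T t x) +
        NormedSpace.exp (s • B n) (T t x) := by
      intro n
      rw [add_smul, exp_add_eq_exp_mul_exp
        (((Commute.refl (B n)).smul_left s).smul_right t), ← map_add, sub_add_cancel]
      rfl
    simp_rw [e]
    have h0 : Tendsto (fun n => NormedSpace.exp (s • B n) (NormedSpace.exp (t • B n) x - T t x))
        atTop (𝓝 0) := by
      refine squeeze_zero_norm (fun n => bexp n s _ hs) ?_
      simpa using ((hT t ht x).sub_const (T t x)).norm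
    simpa using h0.add (hT s hs (T t x))
  · intro x
    rw [Metric.tendsto_nhds]
    intro ε hε
    obtain ⟨z, hzD, hz⟩ := hdense.exists_dist_lt x (show 0 < ε / 4 by positivity)
    rw [dist_eq_norm] at hz
    have h0 : Tendsto (fun t : ℝ => T t z - z) (𝓝[>] 0) (𝓝 0) := by
      have h1 : Tendsto (fun t : ℝ => t) (𝓝[>] 0) (𝓝 0) := tendsto_nhdsWithin_of_tendsto_nhds tendsto_id
      have h2 := h1.smul (hgen ⟨z, hzD⟩)
      rw [zero_smul] at h2
      refine h2.congr' ?_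
      filter_upwards [self_mem_nhdsWithin] with t ht
      rw [smul_smul, mul_inv_cancel₀ (ne_of_gt ht), one_smul]
    rw [Metric.tendsto_nhds] at h0
    filter_upwards [h0 (ε / 2) (by positivity)] with t ht
    rw [dist_zero_right] at ht
    rw [dist_eq_norm]
    have e : T t x - x = T t (x - z) + (T t z - z) - (x - z) := by
      rw [map_sub]
      abel
    rw [e]
    have h4 := norm_sub_le (T t (x - z) + (T t z - z)) (x - z)
    have h5 := norm_add_le (T t (x - z)) (T t z - z)
    have h6 := hTb t (x - z)
    linarith

/-- An operator with `1 - A` surjective that is contained in the generator of a contraction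
semigroup is equal to it. -/
theorem isGenerator_of_tendsto {T : ℝ → E →L[ℂ] E} (hT : IsContractionSemigroup T)
    {A : E →ₗ.[ℂ] E}
    (hA : ∀ x : A.domain, Tendsto (fun t : ℝ => t⁻¹ • (T t x - x)) (𝓝[>] 0) (𝓝 (A x)))
    (hsurj : ∀ y, ∃ x : A.domain, (x : E) - A x = y) : IsGenerator T A := by
  intro x y
  constructor
  · rw [LinearPMap.mem_graph_iff]
    rintro ⟨x, rfl, rfl⟩
    exact hA x
  · intro h
    obtain ⟨x', hx'⟩ := hsurj (x - y)
    -- The generator maps $u=x'-x$ to itself, so $T(t)u=(1+t)u+o(t)$. Contractivity then forces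
    -- $u=0$.
    have hu : Tendsto (fun t : ℝ => t⁻¹ • (T t (x' - x) - (x' - x))) (𝓝[>] 0) (𝓝 (x' - x)) := by
      have h2 := (hA x').sub h
      have e : A x' - y = x' - x := by
        rw [sub_eq_sub_iff_add_eq_add]
        rw [sub_eq_sub_iff_add_eq_add] at hx'
        rw [add_comm (A x'), add_comm (x' : E) y, add_comm y, hx', add_comm]
      rw [e] at h2
      refine h2.congr fun t => ?_
      rw [map_sub, ← smul_sub]
      congr 1
      abel
    have hx : (x' : E) = x := by
      rw [← sub_eq_zero, ← norm_le_zero_iff]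
      have h3 : Tendsto (fun t : ℝ => ‖t⁻¹ • (T t (x' - x) - (x' - x)) - (x' - x)‖) (𝓝[>] 0)
          (𝓝 0) := by
        simpa using (hu.sub_const (x' - x : E)).norm
      refine ge_of_tendsto h3 ?_
      filter_upwards [self_mem_nhdsWithin] with t ht
      have ht : 0 < t := ht
      set u : E := x' - x
      have e : T t u = (1 + t) • u + t • (t⁻¹ • (T t u - u) - u) := by
        rw [smul_sub t, smul_smul, mul_inv_cancel₀ ht.ne']
        module
      have h4 : ‖T t u‖ ≤ ‖u‖ := by
        simpa using (T t).le_of_opNorm_le (hT.norm_le_one t ht.le) u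
      have h5 : ‖(1 + t) • u‖ ≤ ‖T t u‖ + ‖t • (t⁻¹ • (T t u - u) - u)‖ := by
        calc ‖(1 + t) • u‖ = ‖T t u - t • (t⁻¹ • (T t u - u) - u)‖ := by
              rw [eq_sub_of_add_eq e.symm]
          _ ≤ _ := norm_sub_le _ _
      rw [norm_smul, norm_smul, Real.norm_eq_abs, Real.norm_eq_abs, abs_of_pos ht,
        abs_of_pos (by linarith)] at h5
      refine le_of_mul_le_mul_left ?_ ht
      linarith
    subst hx
    have : A x' = y := by simpa using hx'
    rw [← this]
    exact A.mem_graph x'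

/-- The Hille-Yosida theorem for contraction semigroups (sufficiency). -/
theorem generatesContractionSemigroup_of_range [CompleteSpace E] (A : E →ₗ.[ℂ] E)
    (hdense : Dense (A.domain : Set E))
    (hdiss : ∀ c : ℝ, 0 < c → ∀ x : A.domain, c * ‖(x : E)‖ ≤ ‖c • (x : E) - A x‖)
    (hsurj : ∀ c : ℝ, 0 < c → ∀ y, ∃ x : A.domain, c • (x : E) - A x = y) :
    GeneratesContractionSemigroup A := by
  have hinj : ∀ c : ℝ, 0 < c → ∀ x x' : A.domain,
      c • (x : E) - A x = c • (x' : E) - A x' → (x : E) = x' := by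
    intro c hc x x' h
    have h1 := hdiss c hc (x - x')
    have e : c • ((x - x' : A.domain) : E) - A (x - x') = 0 := by
      rw [A.map_sub, Submodule.coe_sub, smul_sub, sub_sub_sub_comm, h, sub_self]
    rw [e, norm_zero] at h1
    have : ‖((x - x' : A.domain) : E)‖ ≤ 0 := by
      by_contra h2
      push Not at h2
      have := mul_pos hc h2
      linarith
    exact sub_eq_zero.1 (norm_le_zero_iff.1 this)
  choose! r hr using hsurj
  have hrn : ∀ c : ℝ, 0 < c → ∀ y, ‖(r c y : E)‖ ≤ c⁻¹ * ‖y‖ := by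
    intro c hc y
    have h := hdiss c hc (r c y)
    rw [hr c hc y] at h
    rw [inv_mul_eq_div, le_div_iff₀ hc, mul_comm]
    exact h
  let c : ℕ → ℝ := fun n => n + 1
  have hc : ∀ n, 0 < c n := fun n => by positivity
  let R : ℕ → E →L[ℂ] E := fun n => LinearMap.mkContinuous
    { toFun := fun y => (r (c n) y : E)
      map_add' := fun x y => by
        rw [← Submodule.coe_add]
        refine hinj _ (hc n) _ _ ?_
        rw [hr _ (hc n), A.map_add, Submodule.coe_add, smul_add, add_sub_add_comm,
          hr _ (hc n), hr _ (hc n)]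
      map_smul' := fun a x => by
        rw [RingHom.id_apply, ← Submodule.coe_smul]
        refine hinj _ (hc n) _ _ ?_
        rw [hr _ (hc n), A.map_smul, Submodule.coe_smul, smul_comm, ← smul_sub, hr _ (hc n)] }
    (c n)⁻¹ (fun y => hrn (c n) (hc n) y)
  have hRr : ∀ n y, R n y = r (c n) y := fun n y => rfl
  have hRnorm : ∀ n, ‖R n‖ ≤ (c n)⁻¹ := fun n =>
    LinearMap.mkContinuous_norm_le _ (inv_nonneg.2 (hc n).le) _
  have hRleft : ∀ n (x : A.domain), R n (c n • (x : E) - A x) = x := fun n x =>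
    hinj _ (hc n) _ _ (hr _ (hc n) _)
  -- The resolvent identity; exchanging `m` and `n` in it shows that the resolvents commute.
  have hres : ∀ m n y, R m y - R n y = (c n - c m) • R m (R n y) := by
    intro m n y
    have h1 : y = (c m • (R n y) - A (r (c n) y)) + (c n - c m) • R n y := by
      conv_lhs => rw [← hr _ (hc n) y]
      rw [hRr]
      module
    have h2 : R m y = R n y + (c n - c m) • R m (R n y) := by
      conv_lhs => rw [h1]
      rw [map_add, hRr n y, hRleft m (r (c n) y), ← hRr n y]
      congr 1
      exact ((R m).restrictScalars ℝ).map_smul _ _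
    rw [h2, add_sub_cancel_left]
  have hRcomm : ∀ m n, Commute (R m) (R n) := by
    intro m n
    rcases eq_or_ne m n with rfl | hmn
    · exact Commute.refl _
    · have hne : c n - c m ≠ 0 := by
        rw [sub_ne_zero]
        intro h
        exact hmn (by simpa [c] using h.symm)
      ext y
      refine smul_right_injective E hne ?_
      change (c n - c m) • R m (R n y) = (c n - c m) • R n (R m y)
      rw [← hres m n y, ← neg_sub (c m), neg_smul, ← hres n m y, neg_sub]
  -- The Yosida approximation, equal to $c_nR_nA$ on the domain of $A$.
  let B : ℕ → E →L[ℂ] E := fun n => c n • (c n • R n - 1)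
  have hJ : ∀ n, ‖c n • R n‖ ≤ 1 := by
    intro n
    rw [norm_smul, Real.norm_eq_abs, abs_of_pos (hc n)]
    calc c n * ‖R n‖ ≤ c n * (c n)⁻¹ := by gcongr; exact hRnorm n
      _ = 1 := mul_inv_cancel₀ (hc n).ne'
  -- On the domain $c_nR_nz-z=R_nAz\to0$; density and $\|c_nR_n\|\le1$ extend this to all vectors.
  have hJlim : ∀ y, Tendsto (fun n => (c n • R n) y) atTop (𝓝 y) := by
    intro y
    rw [Metric.tendsto_atTop]
    intro ε hε
    obtain ⟨z, hzD, hz⟩ := hdense.exists_dist_lt y (show 0 < ε / 4 by positivity)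
    rw [dist_eq_norm] at hz
    obtain ⟨N, hN⟩ := exists_nat_gt (‖A ⟨z, hzD⟩‖ / (ε / 2))
    refine ⟨N, fun n hn => ?_⟩
    have h1 : (c n • R n) z - z = R n (A ⟨z, hzD⟩) := by
      have h := hRleft n ⟨z, hzD⟩
      rw [map_sub, sub_eq_iff_eq_add] at h
      rw [sub_eq_iff_eq_add, add_comm, ← h]
      exact (((R n).restrictScalars ℝ).map_smul _ _).symm
    have h2 : ‖R n (A ⟨z, hzD⟩)‖ < ε / 2 := by
      refine (hrn _ (hc n) _).trans_lt ?_
      rw [inv_mul_eq_div, div_lt_iff₀ (hc n)]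
      rw [div_lt_iff₀ (by positivity)] at hN
      have : (N : ℝ) ≤ c n := by
        have : (N : ℝ) ≤ n := by exact_mod_cast hn
        simp only [c]
        linarith
      nlinarith
    rw [dist_eq_norm]
    have e : (c n • R n) y - y = (c n • R n) (y - z) + ((c n • R n) z - z) - (y - z) := by
      rw [map_sub]
      abel
    rw [e, h1]
    have h4 := norm_sub_le ((c n • R n) (y - z) + R n (A ⟨z, hzD⟩)) (y - z)
    have h5 := norm_add_le ((c n • R n) (y - z)) (R n (A ⟨z, hzD⟩))
    have h6 := (c n • R n).le_of_opNorm_le (hJ n) (y - z)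
    linarith
  have hBA : ∀ n (x : A.domain), B n x = (c n • R n) (A x) := by
    intro n x
    have h := hRleft n x
    rw [map_sub, sub_eq_iff_eq_add] at h
    have h2 : R n (c n • (x : E)) = c n • R n x := ((R n).restrictScalars ℝ).map_smul _ _
    change c n • (c n • R n x - x) = c n • R n (A x)
    rw [← h2, h, add_sub_cancel_left]
  obtain ⟨T, hT, hTA⟩ := exists_contractionSemigroup_of_approx A hdense B
    (fun m n => ((((hRcomm m n).smul_left (c m)).smul_right (c n)).sub_left
      (Commute.one_left _) |>.sub_right (Commute.one_right _)).smul_left (c m) |>.smul_right (c n))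
    (fun n t ht => by
      rw [smul_smul]
      exact norm_exp_smul_sub_one_le_one (hJ n) (mul_nonneg ht (hc n).le))
    (fun x => by
      simp_rw [hBA]
      exact hJlim (A x))
  refine ⟨T, hT, isGenerator_of_tendsto hT hTA fun y => ⟨r 1 y, ?_⟩⟩
  simpa using hr 1 one_pos y

end HilleYosida

end BoundaryControl

namespace BoundaryControl

/-! ### Classical solutions of the inhomogeneous Cauchy problem, and the resolvent of a generator -/

section InhomogeneousCauchyProblem

variable {E : Type*} [NormedAddCommGroup E] [NormedSpace ℂ E]

theorem IsContractionSemigroup.norm_apply_le {T : ℝ → E →L[ℂ] E} (hT : IsContractionSemigroup T)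
    {t : ℝ} (ht : 0 ≤ t) (x : E) : ‖T t x‖ ≤ ‖x‖ := by
  simpa using (T t).le_of_opNorm_le (hT.norm_le_one t ht) x

theorem IsContractionSemigroup.apply_apply {T : ℝ → E →L[ℂ] E} (hT : IsContractionSemigroup T)
    {s t : ℝ} (hs : 0 ≤ s) (ht : 0 ≤ t) (x : E) : T s (T t x) = T (s + t) x := by
  rw [hT.map_add s t hs ht]
  rfl

theorem IsContractionSemigroup.norm_apply_sub_apply_le {T : ℝ → E →L[ℂ] E}
    (hT : IsContractionSemigroup T) {s t : ℝ} (hs : 0 ≤ s) (ht : 0 ≤ t) (x : E) :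
    ‖T s x - T t x‖ ≤ ‖T |s - t| x - x‖ := by
  wlog h : t ≤ s generalizing s t
  · rw [norm_sub_rev, abs_sub_comm]
    exact this ht hs (le_of_not_ge h)
  rw [abs_of_nonneg (sub_nonneg.2 h)]
  have e : T s x - T t x = T t (T (s - t) x - x) := by
    rw [map_sub, hT.apply_apply ht (sub_nonneg.2 h), add_sub_cancel]
  rw [e]
  exact hT.norm_apply_le ht _

/-- Contractivity reduces continuity at any time to right continuity at 0 and makes it locally
uniform in the vector. Freezing negative times at 0 permits two-sided calculus. -/
theorem IsContractionSemigroup.continuous_apply_max {T : ℝ → E →L[ℂ] E}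
    (hT : IsContractionSemigroup T) : Continuous fun q : ℝ × E => T (max q.1 0) q.2 := by
  have h0 : ∀ x, Tendsto (fun r : ℝ => ‖T |r| x - x‖) (𝓝 0) (𝓝 0) := by
    intro x
    have h1 : ContinuousWithinAt (fun t => T t x) (Ioi 0) 0 := by
      have h := hT.strongly_continuous x
      rwa [ContinuousWithinAt, hT.map_zero]
    have h2 := continuousWithinAt_Ioi_iff_Ici.1 h1
    have h3 : Tendsto (fun r : ℝ => |r|) (𝓝 0) (𝓝[≥] 0) := by
      refine tendsto_nhdsWithin_iff.2 ⟨?_, Eventually.of_forall fun r => abs_nonneg r⟩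
      simpa using (continuous_abs (G := ℝ)).tendsto 0
    have h4 := ((h2.tendsto.comp h3).sub_const x).norm
    simpa [hT.map_zero] using h4
  rw [continuous_iff_continuousAt]
  rintro ⟨t, x⟩
  rw [ContinuousAt, tendsto_iff_norm_sub_tendsto_zero]
  have hb : ∀ q : ℝ × E, ‖T (max q.1 0) q.2 - T (max t 0) x‖ ≤
      ‖q.2 - x‖ + ‖T |max q.1 0 - max t 0| x - x‖ := by
    intro q
    have e : T (max q.1 0) q.2 - T (max t 0) x =
        T (max q.1 0) (q.2 - x) + (T (max q.1 0) x - T (max t 0) x) := by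
      rw [map_sub]
      abel
    rw [e]
    exact (norm_add_le _ _).trans (add_le_add (hT.norm_apply_le (le_max_right _ _) _)
      (hT.norm_apply_sub_apply_le (le_max_right _ _) (le_max_right _ _) x))
  refine squeeze_zero (fun q => norm_nonneg _) hb ?_
  have h1 : Tendsto (fun q : ℝ × E => ‖q.2 - x‖) (𝓝 (t, x)) (𝓝 0) := by
    have : Continuous fun q : ℝ × E => ‖q.2 - x‖ := by fun_prop
    simpa using this.tendsto (t, x)
  have h2 : Tendsto (fun q : ℝ × E => max q.1 0 - max t 0) (𝓝 (t, x)) (𝓝 0) := by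
    have : Continuous fun q : ℝ × E => max q.1 0 - max t 0 := by fun_prop
    simpa using this.tendsto (t, x)
  simpa using h1.add ((h0 x).comp h2)

/-- Differentiation of a parametric primitive along a straight line in the parameter plane. -/
theorem hasDerivAt_parametric_primitive {E : Type*} [NormedAddCommGroup E] [NormedSpace ℝ E]
    [CompleteSpace E] {g g' : ℝ → ℝ → E}
    (hg : Continuous fun q : ℝ × ℝ => g q.1 q.2) (hg' : Continuous fun q : ℝ × ℝ => g' q.1 q.2)
    (hgg' : ∀ s b, HasDerivAt (g s) (g' s b) b) (a b : ℝ → ℝ) {a' b' t : ℝ}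
    (ha : HasDerivAt a a' t) (hb : HasDerivAt b b' t) :
    HasDerivAt (fun r => ∫ s in (0 : ℝ)..a r, g s (b r))
      (a' • g (a t) (b t) + b' • ∫ s in (0 : ℝ)..a t, g' s (b t)) t := by
  have hc1 : ∀ c, Continuous fun s => g s c := fun c => hg.comp (Continuous.prodMk_left c)
  have hc2 : ∀ c, Continuous fun s => g' s c := fun c => hg'.comp (Continuous.prodMk_left c)
  have d2 : ∀ x y : ℝ, HasDerivAt (fun y => ∫ s in (0 : ℝ)..x, g s y)
      (∫ s in (0 : ℝ)..x, g' s y) y := by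
    intro x y
    obtain ⟨C, hC⟩ := (isCompact_uIcc (a := (0 : ℝ)) (b := x)).prod
      (isCompact_closedBall y (1 : ℝ)) |>.exists_bound_of_continuousOn hg'.continuousOn
    refine (intervalIntegral.hasDerivAt_integral_of_dominated_loc_of_deriv_le
      (F := fun y s => g s y) (F' := fun y s => g' s y) (bound := fun _ => C)
      (Metric.closedBall_mem_nhds y one_pos)
      (Eventually.of_forall fun c => (hc1 c).aestronglyMeasurable)
      ((hc1 y).intervalIntegrable _ _) (hc2 y).aestronglyMeasurable
      (Eventually.of_forall fun s hs c hcm => hC (s, c) ⟨uIoc_subset_uIcc hs, hcm⟩)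
      intervalIntegrable_const
      (Eventually.of_forall fun s _ c _ => hgg' s c)).2
  have d1 : ∀ x y : ℝ, HasDerivAt (fun x => ∫ s in (0 : ℝ)..x, g s y) (g x y) x := fun x y =>
    (hc1 y).integral_hasStrictDerivAt 0 x |>.hasDerivAt
  have hcont2 : Continuous fun q : ℝ × ℝ => ∫ s in (0 : ℝ)..q.1, g' s q.2 :=
    intervalIntegral.continuous_parametric_intervalIntegral_of_continuous
      (f := fun (q : ℝ × ℝ) s => g' s q.2)
      (hg'.comp (by fun_prop : Continuous fun z : (ℝ × ℝ) × ℝ => (z.2, z.1.2))) continuous_fst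
  have hspan : Continuous fun v : E => ContinuousLinearMap.toSpanSingleton ℝ v :=
    (ContinuousLinearMap.toSpanSingletonCLE (𝕜 := ℝ) (E := E)).continuous
  have hF := hasStrictFDerivAt_uncurry_coprod (𝕜 := ℝ) (u := (a t, b t))
    (f := fun x y => ∫ s in (0 : ℝ)..x, g s y)
    (f₁ := fun x y => ContinuousLinearMap.toSpanSingleton ℝ (g x y))
    (f₂ := fun x y => ContinuousLinearMap.toSpanSingleton ℝ (∫ s in (0 : ℝ)..x, g' s y))
    (Eventually.of_forall fun v => (d1 v.1 v.2).hasFDerivAt)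
    (Eventually.of_forall fun v => (d2 v.1 v.2).hasFDerivAt)
    (hspan.comp hg).continuousAt (hspan.comp hcont2).continuousAt
  have := hF.hasFDerivAt.comp_hasDerivAt t (ha.prodMk hb)
  simpa using! this

/-- The inhomogeneous Cauchy problem `u' = A u + F`, `u(0) = 0`, has a classical solution for a
continuously differentiable inhomogeneity. -/
theorem IsGenerator.exists_classical_solution [CompleteSpace E] {T : ℝ → E →L[ℂ] E}
    {A : E →ₗ.[ℂ] E} (hA : IsGenerator T A) (hT : IsContractionSemigroup T) {F F' : ℝ → E}
    (hF : ∀ t, HasDerivAt F (F' t) t) (hF' : Continuous F') :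
    ∃ u u' : ℝ → E, u 0 = 0 ∧ (∀ t, HasDerivAt u (u' t) t) ∧ Continuous u' ∧
      ∀ t, 0 ≤ t → (u t, u' t - F t) ∈ A.graph := by
  have hFc : Continuous F := continuous_iff_continuousAt.2 fun t => (hF t).continuousAt
  have hg : Continuous fun q : ℝ × ℝ => T (max q.1 0) (F (q.2 - q.1)) :=
    hT.continuous_apply_max.comp
      (by fun_prop : Continuous fun q : ℝ × ℝ => (q.1, F (q.2 - q.1)))
  have hg' : Continuous fun q : ℝ × ℝ => T (max q.1 0) (F' (q.2 - q.1)) :=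
    hT.continuous_apply_max.comp
      (by fun_prop : Continuous fun q : ℝ × ℝ => (q.1, F' (q.2 - q.1)))
  have hgg' : ∀ s b : ℝ, HasDerivAt (fun b => T (max s 0) (F (b - s)))
      (T (max s 0) (F' (b - s))) b := fun s b =>
    ((T (max s 0)).restrictScalars ℝ).hasFDerivAt.comp_hasDerivAt b
      ((hF (b - s)).comp_sub_const b s)
  have hd := fun (a b : ℝ → ℝ) {a' b' t : ℝ} =>
    hasDerivAt_parametric_primitive hg hg' hgg' a b (a' := a') (b' := b') (t := t)
  -- The convolution is written with the shift on `F`, so that differentiation falls on `F` and not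
  -- on the semigroup.
  refine ⟨fun t => ∫ s in (0 : ℝ)..t, T (max s 0) (F (t - s)),
    fun t => T (max t 0) (F (t - t)) + ∫ s in (0 : ℝ)..t, T (max s 0) (F' (t - s)),
    by simp, fun t => by simpa using hd id id (hasDerivAt_id t) (hasDerivAt_id t), ?_, ?_⟩
  · refine (hg.comp (by fun_prop : Continuous fun t : ℝ => (t, t))).add ?_
    exact intervalIntegral.continuous_parametric_intervalIntegral_of_continuous
      (f := fun (t : ℝ) s => T (max s 0) (F' (t - s)))
      (hg'.comp (by fun_prop : Continuous fun z : ℝ × ℝ => (z.2, z.1))) continuous_id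
  · intro t ht
    refine (hA _ _).2 ?_
    -- The difference of the two integrals is $\int_r^{t+r}T(s)F(t+r-s)\,ds=T(r)u(t)$ for $r>0$, and
    -- its derivative at $r=0$ is $u'(t)-F(t)$.
    have h1 := (hd (fun r => t + r) (fun r => t + r) ((hasDerivAt_id (0 : ℝ)).const_add t)
      ((hasDerivAt_id (0 : ℝ)).const_add t)).sub
      (hd (fun r => r) (fun r => t + r) (hasDerivAt_id (0 : ℝ)) ((hasDerivAt_id (0 : ℝ)).const_add t))
    have h2 := h1.tendsto_slope_zero_right
    simp only [Pi.sub_apply, add_zero, zero_add, one_smul, intervalIntegral.integral_same,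
      sub_zero, max_self, hT.map_zero, ContinuousLinearMap.id_apply] at h2
    refine h2.congr' ?_
    filter_upwards [self_mem_nhdsWithin] with h hh
    have hh : 0 < h := hh
    congr 2
    have hcont : ∀ c, Continuous fun s => T (max s 0) (F (c - s)) := fun c =>
      hg.comp (Continuous.prodMk_left c)
    rw [intervalIntegral.integral_interval_sub_left ((hcont _).intervalIntegrable _ _)
      ((hcont _).intervalIntegrable _ _), ← (T h).intervalIntegral_comp_comm
      ((hcont _).intervalIntegrable _ _)]
    have h3 := intervalIntegral.integral_comp_add_right (a := 0) (b := t)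
      (fun s => T (max s 0) (F (t + h - s))) h
    rw [zero_add] at h3
    rw [← h3]
    refine intervalIntegral.integral_congr fun s hs => ?_
    rw [uIcc_of_le ht] at hs
    have hs0 := hs.1
    rw [hT.apply_apply hh.le (le_max_right _ _), max_eq_left hs0,
      max_eq_left (add_nonneg hs0 hh.le), add_comm h s, add_sub_add_right_eq_sub]

/-- The half-line `(0, ∞)` belongs to the resolvent set of the generator of a contraction
semigroup. -/
theorem IsGenerator.exists_smul_sub_eq [CompleteSpace E] {T : ℝ → E →L[ℂ] E}
    {A : E →ₗ.[ℂ] E} (hA : IsGenerator T A) (hT : IsContractionSemigroup T) {c : ℝ} (hc : 0 < c)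
    (y : E) : ∃ x : A.domain, c • (x : E) - A x = y := by
  -- A Laplace integral over $[0,1]$ suffices: $x=\int_0^1e^{-cs}T(s)g\,ds$ satisfies
  -- $(c-A)x=g-e^{-c}T(1)g$, and a Neumann series yields $g$ with right-hand side $y$.
  have hlt : ‖Real.exp (-c) • T 1‖ < 1 := by
    rw [norm_smul, Real.norm_eq_abs, Real.abs_exp]
    calc Real.exp (-c) * ‖T 1‖ ≤ Real.exp (-c) * 1 := by
          gcongr
          exact hT.norm_le_one 1 zero_le_one
      _ < 1 := by rw [mul_one, Real.exp_lt_one_iff]; linarith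
  obtain ⟨g, hg⟩ : ∃ g, g - Real.exp (-c) • T 1 g = y := by
    obtain ⟨U, hU⟩ := isUnit_one_sub_of_norm_lt_one hlt
    refine ⟨((U⁻¹ : (E →L[ℂ] E)ˣ) : E →L[ℂ] E) y, ?_⟩
    have h := congrArg (fun M : E →L[ℂ] E => M y) U.mul_inv
    rw [hU] at h
    exact h
  let φ : ℝ → E := fun s => Real.exp (-c * s) • T (max s 0) g
  have hφ : Continuous φ := by
    have := hT.continuous_apply_max.comp (by fun_prop : Continuous fun s : ℝ => (s, g))
    exact (by fun_prop : Continuous fun s : ℝ => Real.exp (-c * s)).smul this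
  have hint : ∀ a b, IntervalIntegrable φ MeasureTheory.volume a b := fun a b =>
    hφ.intervalIntegrable a b
  have hΦ : ∀ t, HasDerivAt (fun t => ∫ s in (0 : ℝ)..t, φ s) (φ t) t := fun t =>
    (hφ.integral_hasStrictDerivAt 0 t).hasDerivAt
  -- For $h>0$ the differentiated function is $T(h)x$.
  have h1 : HasDerivAt (fun h : ℝ => Real.exp (c * h) • ((∫ s in (0 : ℝ)..1 + h, φ s) -
      ∫ s in (0 : ℝ)..h, φ s)) (φ 1 - φ 0 + c • ∫ s in (0 : ℝ)..1, φ s) 0 := by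
    have he : HasDerivAt (fun h : ℝ => Real.exp (c * h)) c 0 := by
      have := ((hasDerivAt_id (0 : ℝ)).const_mul c).exp
      simpa using this
    have h2 : HasDerivAt (fun h : ℝ => ∫ s in (0 : ℝ)..1 + h, φ s) (φ 1) 0 := by
      exact (hΦ (1 + 0)).comp_const_add 1 0 |>.congr_deriv (by rw [add_zero])
    simpa using! he.smul (h2.sub (hΦ 0))
  have h2 := h1.tendsto_slope_zero_right
  have hgr : ((∫ s in (0 : ℝ)..1, φ s), φ 1 - φ 0 + c • ∫ s in (0 : ℝ)..1, φ s) ∈ A.graph := by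
    refine (hA _ _).2 (h2.congr' ?_)
    filter_upwards [self_mem_nhdsWithin] with h hh
    have hh : 0 < h := hh
    simp only [zero_add, mul_zero, Real.exp_zero, add_zero, intervalIntegral.integral_same,
      sub_zero, one_smul]
    congr 2
    rw [intervalIntegral.integral_interval_sub_left (hint _ _) (hint _ _),
      ← (T h).intervalIntegral_comp_comm (hint _ _), ← intervalIntegral.integral_smul]
    have h3 := intervalIntegral.integral_comp_add_right (a := 0) (b := 1)
      (fun s => Real.exp (c * h) • φ s) h
    rw [zero_add] at h3
    rw [← h3]
    refine intervalIntegral.integral_congr fun s hs => ?_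
    rw [uIcc_of_le zero_le_one] at hs
    have hs0 := hs.1
    have e : T h (Real.exp (-c * s) • T (max s 0) g) = Real.exp (-c * s) • T h (T (max s 0) g) :=
      ((T h).restrictScalars ℝ).map_smul _ _
    simp only [φ]
    rw [e, hT.apply_apply hh.le (le_max_right _ _), max_eq_left hs0,
      max_eq_left (add_nonneg hs0 hh.le), add_comm h s, smul_smul, ← Real.exp_add]
    congr 2
    ring
  rw [LinearPMap.mem_graph_iff] at hgr
  obtain ⟨x, hx, hAx⟩ := hgr
  refine ⟨x, ?_⟩
  simp only at hx hAx
  rw [hAx, hx, ← hg]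
  simp only [φ]
  rw [max_self, max_eq_left zero_le_one, hT.map_zero]
  simp

end InhomogeneousCauchyProblem

end BoundaryControl

namespace BoundaryControl

/-! ### The Lumer-Phillips theorem on a Hilbert space -/

section LumerPhillips

variable {E : Type*} [NormedAddCommGroup E] [InnerProductSpace ℂ E]

theorem mul_norm_le_norm_smul_sub {x y : E} (h : (inner ℂ y x).re ≤ 0) (c : ℝ) :
    c * ‖x‖ ≤ ‖c • x - y‖ := by
  rcases eq_or_ne x 0 with rfl | hx
  · simp
  have hx : 0 < ‖x‖ := norm_pos_iff.2 hx
  refine le_of_mul_le_mul_right ?_ hx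
  have h1 : (inner ℂ (c • x - y) x).re = c * ‖x‖ * ‖x‖ - (inner ℂ y x).re := by
    rw [inner_sub_left, ← Complex.coe_smul c x, inner_smul_left, Complex.sub_re,
      Complex.conj_ofReal, Complex.re_ofReal_mul]
    have : (inner ℂ x x).re = ‖x‖ * ‖x‖ := inner_self_eq_norm_mul_norm (𝕜 := ℂ) x
    rw [this, mul_assoc]
  have h2 := (Complex.re_le_norm _).trans (norm_inner_le_norm (𝕜 := ℂ) (c • x - y) x)
  linarith

/-- An m-dissipative operator on a Hilbert space generates a contraction semigroup; its domain is
automatically dense. -/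
theorem generatesContractionSemigroup_of_dissipative [CompleteSpace E] (A : E →ₗ.[ℂ] E)
    (hdiss : ∀ x : A.domain, (inner ℂ (A x) (x : E)).re ≤ 0)
    (hsurj : ∀ c : ℝ, 0 < c → ∀ y, ∃ x : A.domain, c • (x : E) - A x = y) :
    GeneratesContractionSemigroup A := by
  refine generatesContractionSemigroup_of_range A ?_
    (fun c _ x => mul_norm_le_norm_smul_sub (hdiss x) c) hsurj
  rw [Submodule.dense_iff_topologicalClosure_eq_top, Submodule.topologicalClosure_eq_top_iff,
    Submodule.eq_bot_iff]
  intro y hy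
  -- For $y=x-Ax$ orthogonal to the domain, $\langle y,x\rangle=0$ gives
  -- $\|x\|^2=\operatorname{Re}\langle Ax,x\rangle\le0$.
  obtain ⟨x, hx⟩ := hsurj 1 one_pos y
  have h1 : inner ℂ y (x : E) = 0 := Submodule.inner_left_of_mem_orthogonal x.2 hy
  rw [one_smul] at hx
  have h2 : (inner ℂ (x : E) (x : E)).re = ‖(x : E)‖ * ‖(x : E)‖ :=
    inner_self_eq_norm_mul_norm (𝕜 := ℂ) (x : E)
  rw [← hx, inner_sub_left, sub_eq_zero] at h1
  have h3 := hdiss x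
  rw [← h1, h2] at h3
  have h4 : (x : E) = 0 := norm_eq_zero.1 (by nlinarith [norm_nonneg (x : E)])
  have h5 : x = 0 := Subtype.ext h4
  rw [← hx, h5, A.map_zero]
  simp

end LumerPhillips

/-! ### Extension of smooth data from the half-line to the line -/

section Extension

variable {V : Type*} [NormedAddCommGroup V] [NormedSpace ℝ V] [CompleteSpace V]

theorem exists_hasDerivAt_eqOn_Ici {f g G : ℝ → V} (hf : ContinuousOn f (Ici 0))
    (hfg : ∀ t, 0 ≤ t → HasDerivWithinAt f (g t) (Ici 0) t) (hG : Continuous G)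
    (hGg : ∀ t, 0 ≤ t → G t = g t) :
    ∃ F : ℝ → V, (∀ t, HasDerivAt F (G t) t) ∧ ∀ t, 0 ≤ t → F t = f t := by
  refine ⟨fun t => f 0 + ∫ s in (0 : ℝ)..t, G s, fun t =>
    ((hG.integral_hasStrictDerivAt 0 t).hasDerivAt).const_add _, fun t ht => ?_⟩
  beta_reduce
  rw [intervalIntegral.integral_eq_sub_of_hasDeriv_right_of_le ht
    (hf.mono Icc_subset_Ici_self) (fun s hs => ?_) (hG.intervalIntegrable _ _)]
  · abel
  · rw [hGg s hs.1.le]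
    exact (hfg s hs.1.le).mono (Ioi_subset_Ici hs.1.le)

theorem exists_extension_of_contDiffOn_one {f : ℝ → V} (hf : ContDiffOn ℝ 1 f (Ici 0)) :
    ∃ F F' : ℝ → V, (∀ t, HasDerivAt F (F' t) t) ∧ Continuous F' ∧ ∀ t, 0 ≤ t → F t = f t := by
  have hG : Continuous fun t : ℝ => derivWithin f (Ici 0) (max t 0) :=
    ContinuousOn.comp_continuous (hf.continuousOn_derivWithin (uniqueDiffOn_Ici 0) le_rfl)
      (by fun_prop) fun t => le_max_right t 0
  obtain ⟨F, hF, hFf⟩ := exists_hasDerivAt_eqOn_Ici hf.continuousOn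
    (fun t ht => (hf.differentiableOn one_ne_zero t ht).hasDerivWithinAt) hG
    fun t ht => by rw [max_eq_left ht]
  exact ⟨F, _, hF, hG, hFf⟩

/-- The derivative is extended first, as a $C^1$ function, and then integrated from the value at 0.
-/
theorem exists_extension_of_contDiffOn_two {f : ℝ → V} (hf : ContDiffOn ℝ 2 f (Ici 0)) :
    ∃ F F' F'' : ℝ → V, (∀ t, HasDerivAt F (F' t) t) ∧ (∀ t, HasDerivAt F' (F'' t) t) ∧
      Continuous F'' ∧ ∀ t, 0 ≤ t → F t = f t := by
  obtain ⟨G, G', hG, hG', hGf⟩ := exists_extension_of_contDiffOn_one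
    (hf.derivWithin (uniqueDiffOn_Ici 0) (m := 1) (by norm_num))
  obtain ⟨F, hF, hFf⟩ := exists_hasDerivAt_eqOn_Ici hf.continuousOn
    (fun t ht => (hf.differentiableOn two_ne_zero t ht).hasDerivWithinAt)
    (continuous_iff_continuousAt.2 fun t => (hG t).continuousAt) hGf
  exact ⟨F, G, G', hF, hG, hG', hFf⟩

theorem contDiffOn_one_Icc {V : Type*} [NormedAddCommGroup V] [NormedSpace ℝ V] {f f' : ℝ → V}
    (hf : ∀ t, 0 ≤ t → HasDerivWithinAt f (f' t) (Ici 0) t) (hf' : ContinuousOn f' (Ici 0))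
    {b : ℝ} (hb : 0 < b) : ContDiffOn ℝ 1 f (Icc 0 b) := by
  have hd : ∀ t ∈ Icc 0 b, HasDerivWithinAt f (f' t) (Icc 0 b) t := fun t ht =>
    (hf t ht.1).mono Icc_subset_Ici_self
  rw [contDiffOn_one_iff_derivWithin (uniqueDiffOn_Icc hb)]
  refine ⟨fun t ht => (hd t ht).differentiableWithinAt, ?_⟩
  exact (hf'.mono Icc_subset_Ici_self).congr fun t ht =>
    (hd t ht).derivWithin (uniqueDiffOn_Icc hb t ht)

end Extension

/-! ### Abstract boundary control systems -/

section Abstract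

theorem hasDerivAt_clm_comp {V W : Type*} [NormedAddCommGroup V] [NormedSpace ℂ V]
    [NormedAddCommGroup W] [NormedSpace ℂ W] (L : V →L[ℂ] W) {f : ℝ → V} {f' : V} {t : ℝ}
    (h : HasDerivAt f f' t) : HasDerivAt (fun r => L (f r)) (L f') t :=
  (L.restrictScalars ℝ).hasFDerivAt.comp_hasDerivAt t h

theorem hasDerivWithinAt_clm_comp {V W : Type*} [NormedAddCommGroup V] [NormedSpace ℂ V]
    [NormedAddCommGroup W] [NormedSpace ℂ W] (L : V →L[ℂ] W) {f : ℝ → V} {f' : V} {s : Set ℝ}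
    {t : ℝ} (h : HasDerivWithinAt f f' s t) : HasDerivWithinAt (fun r => L (f r)) (L f') s t :=
  (L.restrictScalars ℝ).hasFDerivAt.comp_hasDerivWithinAt t h

variable {E D W : Type*} [NormedAddCommGroup E] [NormedSpace ℂ E] [CompleteSpace E]
  [NormedAddCommGroup D] [NormedSpace ℂ D] [CompleteSpace D]
  [NormedAddCommGroup W] [NormedSpace ℂ W]

/-- Classical solutions of the abstract boundary control system
`(ι ξ)' = 𝔄 ξ + f`, `𝔅 ξ = w`. -/
theorem exists_classical_state (ι : D →L[ℂ] E) (hι : Function.Injective ι) (𝔄 : D →L[ℂ] E)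
    (𝔅 : D →L[ℂ] W) (G : W →L[ℂ] D) (hG : ∀ v, 𝔅 (G v) = v)
    (hgen : GeneratesContractionSemigroup (restrictTo ι hι 𝔄 (𝔅 : D →ₗ[ℂ] W).ker))
    (hinj : ∀ z, 𝔅 z = 0 → ι z = 𝔄 z → z = 0)
    {w w' w'' : ℝ → W} (hw : ∀ t, HasDerivAt w (w' t) t) (hw' : ∀ t, HasDerivAt w' (w'' t) t)
    (hw'' : Continuous w'') {f f' : ℝ → E} (hf : ∀ t, HasDerivAt f (f' t) t)
    (hf' : Continuous f') (z₀ : D) (hz₀ : 𝔅 z₀ = w 0) :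
    ∃ ξ : ℝ → D, ξ 0 = z₀ ∧ ContinuousOn ξ (Ici 0) ∧ (∀ t, 0 ≤ t → 𝔅 (ξ t) = w t) ∧
      ∀ t, 0 ≤ t → HasDerivWithinAt (fun s => ι (ξ s)) (𝔄 (ξ t) + f t) (Ici 0) t := by
  obtain ⟨T, hT, hA⟩ := hgen
  have hwc : Continuous w := continuous_iff_continuousAt.2 fun t => (hw t).continuousAt
  have hwc' : Continuous w' := continuous_iff_continuousAt.2 fun t => (hw' t).continuousAt
  have hfc : Continuous f := continuous_iff_continuousAt.2 fun t => (hf t).continuousAt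
  -- Ansatz $\xi=\zeta+(z_0-Gw(0))+Gw$: the constant lies in $\ker\mathfrak B$, and $\zeta$ has zero
  -- initial and boundary values and inhomogeneity `F`. Since `F` contains $\iota Gw'$ and must be
  -- $C^1$, two derivatives of $w$ are needed.
  let F : ℝ → E := fun t => 𝔄 (G (w t)) + f t - ι (G (w' t)) + 𝔄 (z₀ - G (w 0))
  have hF : ∀ t, HasDerivAt F (𝔄 (G (w' t)) + f' t - ι (G (w'' t))) t := fun t =>
    (((hasDerivAt_clm_comp (𝔄 ∘L G) (hw t)).add (hf t)).sub
      (hasDerivAt_clm_comp (ι ∘L G) (hw' t))).add_const _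
  have hFc : Continuous F := continuous_iff_continuousAt.2 fun t => (hF t).continuousAt
  obtain ⟨u, u', hu0, hu, hu'c, hug⟩ := hA.exists_classical_solution hT hF (by fun_prop)
  have huc : Continuous u := continuous_iff_continuousAt.2 fun t => (hu t).continuousAt
  let V : Submodule ℂ D := (𝔅 : D →ₗ[ℂ] W).ker
  have hVc : IsClosed (V : Set D) := 𝔅.isClosed_ker
  have : CompleteSpace V := hVc.completeSpace_coe
  let R : V →L[ℂ] E := (ι - 𝔄) ∘L V.subtypeL
  -- The bounded inverse theorem makes $\zeta=(\iota-\mathfrak A)^{-1}(u-(u'-F))$ continuous in the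
  -- norm of `D`, not only in that of `E`.
  let Re : V ≃L[ℂ] E := ContinuousLinearEquiv.ofBijective R
    (by
      refine (Submodule.eq_bot_iff _).2 fun z hz => Subtype.ext ?_
      exact hinj z z.2 (sub_eq_zero.1 hz))
    (by
      refine (Submodule.eq_top_iff').2 fun y => ?_
      obtain ⟨x, hx⟩ := hA.exists_smul_sub_eq hT one_pos y
      obtain ⟨z, hz, hz1, hz2⟩ := (mem_graph_restrictTo ι hι 𝔄 V _ _).1
        ((restrictTo ι hι 𝔄 V).mem_graph x)
      refine ⟨⟨z, hz⟩, ?_⟩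
      rw [← hx, one_smul, ← hz1, ← hz2]
      rfl)
  let ζ : ℝ → D := fun t => (Re.symm (u t - (u' t - F t)) : D)
  have hζc : Continuous ζ := by fun_prop
  have hζ : ∀ t, 0 ≤ t → 𝔅 (ζ t) = 0 ∧ ι (ζ t) = u t ∧ 𝔄 (ζ t) = u' t - F t := by
    intro t ht
    obtain ⟨z, hz, hz1, hz2⟩ := (mem_graph_restrictTo ι hι 𝔄 V _ _).1 (hug t ht)
    have h : Re.symm (u t - (u' t - F t)) = ⟨z, hz⟩ := by
      rw [ContinuousLinearEquiv.symm_apply_eq, ← hz1, ← hz2]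
      rfl
    have h' : ζ t = z := congrArg Subtype.val h
    rw [h']
    exact ⟨hz, hz1, hz2⟩
  have hζ0 : ζ 0 = 0 := by
    refine hι ?_
    rw [(hζ 0 le_rfl).2.1, hu0, map_zero]
  refine ⟨fun t => ζ t + (z₀ - G (w 0)) + G (w t), ?_, ?_, ?_, ?_⟩
  · simp [hζ0]
  · exact Continuous.continuousOn (by fun_prop)
  · intro t ht
    rw [map_add, map_add, map_sub, (hζ t ht).1, hz₀, hG, hG]
    simp
  · intro t ht
    have h1 : HasDerivWithinAt (fun s => u s + ι (z₀ - G (w 0)) + ι (G (w s)))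
        (u' t + ι (G (w' t))) (Ici 0) t :=
      (((hu t).add_const _).add (hasDerivAt_clm_comp (ι ∘L G) (hw t))).hasDerivWithinAt
    have h2 : 𝔄 (ζ t + (z₀ - G (w 0)) + G (w t)) + f t = u' t + ι (G (w' t)) := by
      rw [map_add, map_add, (hζ t ht).2.2]
      simp only [F]
      abel
    rw [h2]
    refine h1.congr (fun s hs => ?_) ?_
    · rw [map_add, map_add, (hζ s hs).2.1]
    · rw [map_add, map_add, (hζ t ht).2.1]

end Abstract

end BoundaryControl

namespace BoundaryControl

/-! ### Passivity and well-posedness of the closed loop -/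

namespace BCSystem

variable {X Z : Type*} [NormedAddCommGroup X] [InnerProductSpace ℂ X]
  [NormedAddCommGroup Z] [InnerProductSpace ℂ Z] {p n₁ n₃ n : ℕ}

theorem ιe_apply (S : BCSystem X Z p n₁ n₃) (z : WithLp 2 (Z × Cn n)) :
    S.ιe n z = WithLp.toLp 2 (S.ι z.fst, z.snd) := rfl

theorem 𝔄e_apply (S : BCSystem X Z p n₁ n₃) (K : Controller n p) (z : WithLp 2 (Z × Cn n)) :
    S.𝔄e K z = WithLp.toLp 2
      (S.𝔄₀ z.fst, -((K.δ_c : ℂ) • K.B_c (S.ℭ z.fst)) + K.J_c z.snd) := rfl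

theorem 𝔅e_apply (S : BCSystem X Z p n₁ n₃) (K : Controller n p) (z : WithLp 2 (Z × Cn n)) :
    S.𝔅e K z = (S.𝔅 z.fst - (K.δ_c : ℂ) • K.B_c.adjoint z.snd, S.𝔅_d z.fst) := rfl

theorem 𝔅e_eq_zero_iff (S : BCSystem X Z p n₁ n₃) (K : Controller n p)
    (z : WithLp 2 (Z × Cn n)) :
    S.𝔅e K z = 0 ↔ S.𝔅 z.fst = (K.δ_c : ℂ) • K.B_c.adjoint z.snd ∧ S.𝔅_d z.fst = 0 := by
  rw [𝔅e_apply, Prod.mk_eq_zero, sub_eq_zero]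

theorem StandingAssumption.exists_resolvent [CompleteSpace X] {S : BCSystem X Z p n₁ n₃}
    (hS : S.StandingAssumption) {c : ℝ} (hc : 0 < c) (f : X) :
    ∃ z, S.𝔅 z = 0 ∧ S.𝔅_d z = 0 ∧ (c : ℂ) • S.ι z - S.𝔄₀ z = f := by
  obtain ⟨T, hT, hA⟩ := hS.generates
  obtain ⟨x, hx⟩ := hA.exists_smul_sub_eq hT hc f
  obtain ⟨z, hz, hz1, hz2⟩ := (mem_graph_restrictTo S.ι S.ι_injective S.𝔄₀ _ _ _).1
    (S.A.mem_graph x)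
  refine ⟨z, hz.1, hz.2, ?_⟩
  rw [hz1, hz2, Complex.coe_smul]
  exact hx

/-- The operator `P(c)` that maps boundary inputs to solutions of the stationary problem
`(c - 𝔄₀) z = 0`, `𝔅 z = v`, `𝔅_d z = 0`. -/
theorem StandingAssumption.exists_inputMap [CompleteSpace X] {S : BCSystem X Z p n₁ n₃}
    (hS : S.StandingAssumption) {c : ℝ} (hc : 0 < c) :
    ∃ P : Cn p →ₗ[ℂ] Z, ∀ v, S.𝔅 (P v) = v ∧ S.𝔅_d (P v) = 0 ∧
      (c : ℂ) • S.ι (P v) - S.𝔄₀ (P v) = 0 := by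
  let N : Submodule ℂ Z := (S.𝔅_d : Z →ₗ[ℂ] Cn n₃).ker ⊓
    ((c : ℂ) • S.ι - S.𝔄₀ : Z →L[ℂ] X).toLinearMap.ker
  have hsurj : Function.Surjective ((S.𝔅 : Z →ₗ[ℂ] Cn p) ∘ₗ N.subtype) := by
    intro v
    obtain ⟨z, hz⟩ := hS.surjective (v, 0)
    obtain ⟨hz1, hz2⟩ := Prod.mk_inj.1 hz
    -- Subtracting a vector with zero boundary values and the same residual makes `z` stationary
    -- without changing its boundary data.
    obtain ⟨r, hr1, hr2, hr3⟩ := hS.exists_resolvent hc ((c : ℂ) • S.ι z - S.𝔄₀ z)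
    refine ⟨⟨z - r, ?_, ?_⟩, ?_⟩
    · change S.𝔅_d (z - r) = 0
      rw [map_sub, hz2, hr2, sub_zero]
    · change (c : ℂ) • S.ι (z - r) - S.𝔄₀ (z - r) = 0
      rw [map_sub, map_sub, smul_sub, sub_sub_sub_comm, hr3, sub_self]
    · change S.𝔅 (z - r) = v
      rw [map_sub, hz1, hr1, sub_zero]
  obtain ⟨Q, hQ⟩ := LinearMap.exists_rightInverse_of_surjective _ (LinearMap.range_eq_top.2 hsurj)
  exact ⟨N.subtype ∘ₗ Q, fun v => ⟨LinearMap.congr_fun hQ v, (Q v).2.1, (Q v).2.2⟩⟩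

theorem re_inner_skewAdjoint {J : Cn n →L[ℂ] Cn n} (hJ : J.adjoint = -J) (k : Cn n) :
    (inner ℂ (J k) k).re = 0 := by
  have h1 : inner ℂ (J k) k = -inner ℂ k (J k) := by
    rw [← ContinuousLinearMap.adjoint_inner_right, hJ, neg_apply,
      inner_neg_right]
  have h2 : (inner ℂ k (J k)).re = (inner ℂ (J k) k).re := inner_re_symm (𝕜 := ℂ) k (J k)
  have h3 := congrArg Complex.re h1
  rw [Complex.neg_re, h2] at h3
  linarith

/-- The power balance: passivity with the feedback law inserted, and $B_c^*$ moved across the inner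
product. -/
theorem StandingAssumption.re_inner_controller_le {S : BCSystem X Z p n₁ n₃}
    (hS : S.StandingAssumption) (K : Controller n p) {z : Z} {k : Cn n}
    (hz : S.𝔅 z = (K.δ_c : ℂ) • K.B_c.adjoint k) (hzd : S.𝔅_d z = 0) :
    (inner ℂ (S.𝔄₀ z) (S.ι z)).re ≤ (inner ℂ ((K.δ_c : ℂ) • K.B_c (S.ℭ z)) k).re := by
  refine (hS.passive z hzd).trans (le_of_eq ?_)
  rw [hz, inner_smul_left, inner_smul_left, ContinuousLinearMap.adjoint_inner_left,
    Complex.conj_ofReal, Complex.re_ofReal_mul, Complex.re_ofReal_mul]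
  congr 1
  exact inner_re_symm (𝕜 := ℂ) _ _

theorem StandingAssumption.dissipative {S : BCSystem X Z p n₁ n₃}
    (hS : S.StandingAssumption) {K : Controller n p} (hJ : K.J_c.adjoint = -K.J_c)
    {z : WithLp 2 (Z × Cn n)} (hz : S.𝔅e K z = 0) :
    (inner ℂ (S.𝔄e K z) (S.ιe n z)).re ≤ 0 := by
  obtain ⟨h1, h2⟩ := (S.𝔅e_eq_zero_iff K z).1 hz
  rw [𝔄e_apply, ιe_apply, WithLp.prod_inner_apply]
  simp only [inner_add_left, inner_neg_left, Complex.add_re, Complex.neg_re]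
  have h3 := hS.re_inner_controller_le K h1 h2
  have h4 := re_inner_skewAdjoint hJ z.snd
  linarith

/-- Eliminating the plant through $z=r+P(\delta_cB_c^*k)$, with $r$ from the resolvent of $A$,
leaves $Mk=y_c-\delta_cB_c\mathfrak Cr$ for the Schur complement $M=c-J_c+\delta_c^2B_c\mathfrak
CPB_c^*$. Passivity gives $\operatorname{Re}\langle Mk,k\rangle\ge c\|k\|^2$, so $M$ is injective
and, in finite dimension, surjective. -/
theorem StandingAssumption.exists_closedLoop_resolvent [CompleteSpace X]
    {S : BCSystem X Z p n₁ n₃} (hS : S.StandingAssumption) {K : Controller n p}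
    (hJ : K.J_c.adjoint = -K.J_c) {c : ℝ} (hc : 0 < c) (y : WithLp 2 (X × Cn n)) :
    ∃ z, S.𝔅e K z = 0 ∧ (c : ℂ) • S.ιe n z - S.𝔄e K z = y := by
  obtain ⟨P, hP⟩ := hS.exists_inputMap hc
  let M : Cn n →ₗ[ℂ] Cn n := (c : ℂ) • LinearMap.id - (K.J_c : Cn n →ₗ[ℂ] Cn n) +
    (K.δ_c : ℂ) • ((K.B_c ∘L S.ℭ : Z →L[ℂ] Cn n) : Z →ₗ[ℂ] Cn n) ∘ₗ P ∘ₗ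
      ((K.δ_c : ℂ) • (K.B_c.adjoint : Cn n →ₗ[ℂ] Cn p))
  have hM : ∀ k, M k = (c : ℂ) • k - K.J_c k +
      (K.δ_c : ℂ) • K.B_c (S.ℭ (P ((K.δ_c : ℂ) • K.B_c.adjoint k))) := fun k => rfl
  have hMinj : Function.Injective M := by
    refine (injective_iff_map_eq_zero M).2 fun k hk => ?_
    obtain ⟨h1, h2, h3⟩ := hP ((K.δ_c : ℂ) • K.B_c.adjoint k)
    have h4 := hS.re_inner_controller_le K h1 h2
    rw [hM] at hk
    generalize P ((K.δ_c : ℂ) • K.B_c.adjoint k) = z at *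
    have h5 := congrArg (fun v => (inner ℂ v k).re) hk
    simp only [inner_add_left, inner_sub_left, inner_zero_left, Complex.add_re, Complex.sub_re,
      Complex.zero_re] at h5
    rw [re_inner_skewAdjoint hJ, inner_smul_left, Complex.conj_ofReal,
      Complex.re_ofReal_mul] at h5
    rw [← sub_eq_zero.1 h3, inner_smul_left, Complex.conj_ofReal, Complex.re_ofReal_mul] at h4
    have h6 : (inner ℂ k k).re = ‖k‖ * ‖k‖ := inner_self_eq_norm_mul_norm (𝕜 := ℂ) k
    have h7 : 0 ≤ (inner ℂ (S.ι z) (S.ι z)).re := inner_self_nonneg (𝕜 := ℂ)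
    rw [h6] at h5
    have h8 : 0 ≤ c * (inner ℂ (S.ι z) (S.ι z)).re := mul_nonneg hc.le h7
    have h9 : c * (‖k‖ * ‖k‖) ≤ 0 := by linarith
    have h10 : ‖k‖ * ‖k‖ ≤ 0 := by
      by_contra h
      push Not at h
      have := mul_pos hc h
      linarith
    exact norm_eq_zero.1 (by nlinarith [norm_nonneg k])
  obtain ⟨r, hr1, hr2, hr3⟩ := hS.exists_resolvent hc y.fst
  obtain ⟨k, hk⟩ := (LinearMap.injective_iff_surjective.1 hMinj)
    (y.snd - (K.δ_c : ℂ) • K.B_c (S.ℭ r))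
  obtain ⟨h1, h2, h3⟩ := hP ((K.δ_c : ℂ) • K.B_c.adjoint k)
  rw [hM] at hk
  generalize P ((K.δ_c : ℂ) • K.B_c.adjoint k) = z at *
  refine ⟨WithLp.toLp 2 (r + z, k), (S.𝔅e_eq_zero_iff K _).2 ⟨?_, ?_⟩, ?_⟩
  · change S.𝔅 (r + z) = _
    rw [map_add, hr1, h1, zero_add]
    rfl
  · change S.𝔅_d (r + z) = 0
    rw [map_add, hr2, h2, zero_add]
  · rw [ιe_apply, 𝔄e_apply, ← WithLp.toLp_smul, ← WithLp.toLp_sub]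
    refine (WithLp.ofLp_injective 2) (Prod.ext ?_ ?_)
    · change (c : ℂ) • S.ι (r + z) - S.𝔄₀ (r + z) = y.fst
      rw [map_add, map_add, smul_add, add_sub_add_comm, hr3, h3, add_zero]
    · change (c : ℂ) • k - (-((K.δ_c : ℂ) • K.B_c (S.ℭ (r + z))) + K.J_c k) = y.snd
      rw [map_add, map_add, smul_add]
      rw [eq_sub_iff_add_eq] at hk
      rw [← hk]
      abel

theorem StandingAssumption.generates_closedLoop [CompleteSpace X]
    {S : BCSystem X Z p n₁ n₃} (hS : S.StandingAssumption) {K : Controller n p}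
    (hJ : K.J_c.adjoint = -K.J_c) : GeneratesContractionSemigroup (S.Ae K) := by
  refine generatesContractionSemigroup_of_dissipative _ (fun x => ?_) fun c hc y => ?_
  · obtain ⟨z, hz, hz1, hz2⟩ := (mem_graph_restrictTo (S.ιe n) (S.ιe_injective n) (S.𝔄e K) _ _ _).1
      ((S.Ae K).mem_graph x)
    rw [← hz1, ← hz2]
    exact hS.dissipative hJ hz
  · obtain ⟨z, hz, hzy⟩ := hS.exists_closedLoop_resolvent hJ hc y
    have hg := (mem_graph_restrictTo (S.ιe n) (S.ιe_injective n) (S.𝔄e K)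
      (S.𝔅e K : WithLp 2 (Z × Cn n) →ₗ[ℂ] Cn p × Cn n₃).ker _ _).2 ⟨z, hz, rfl, rfl⟩
    obtain ⟨x, hx, hAx⟩ := LinearPMap.mem_graph_iff _ |>.1 hg
    refine ⟨x, ?_⟩
    rw [← hzy, Complex.coe_smul]
    exact congrArg₂ (fun a b => c • a - b) hx hAx

/-- Surjectivity already holds with $x_c=0$, and a finite-dimensional target provides a bounded
right inverse. -/
theorem StandingAssumption.exists_lift {S : BCSystem X Z p n₁ n₃} (hS : S.StandingAssumption)
    (K : Controller n p) :
    ∃ G : Cn p × Cn n₃ →L[ℂ] WithLp 2 (Z × Cn n), ∀ v, S.𝔅e K (G v) = v := by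
  have hsurj : Function.Surjective (S.𝔅e K) := by
    intro v
    obtain ⟨z, hz⟩ := hS.surjective v
    refine ⟨WithLp.toLp 2 (z, 0), ?_⟩
    rw [𝔅e_apply, ← hz]
    simp
  obtain ⟨G, hG⟩ := (S.𝔅e K).exists_rightInverse_of_surjective (LinearMap.range_eq_top.2 hsurj)
  exact ⟨G, fun v => congrArg (fun M : Cn p × Cn n₃ →L[ℂ] Cn p × Cn n₃ => M v) hG⟩

/-- The input operator `(w₁, y_ref) ↦ (B_d w₁, δ_c B_c y_ref)` of the closed loop. -/
noncomputable def inputE (S : BCSystem X Z p n₁ n₃) (K : Controller n p) :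
    Cn n₁ × Cn p →L[ℂ] WithLp 2 (X × Cn n) :=
  ((WithLp.prodContinuousLinearEquiv 2 ℂ X (Cn n)).symm : X × Cn n →L[ℂ] WithLp 2 (X × Cn n)) ∘L
    (S.B_d.prodMap ((K.δ_c : ℂ) • K.B_c))

theorem StandingAssumption.exists_closedLoopState [CompleteSpace X] [CompleteSpace Z]
    {S : BCSystem X Z p n₁ n₃} (hS : S.StandingAssumption) {K : Controller n p}
    (hJ : K.J_c.adjoint = -K.J_c) {yref : ℝ → Cn p} {w₁ : ℝ → Cn n₁} {w₂ : ℝ → Cn p}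
    {w₃ : ℝ → Cn n₃} (hyref : ContDiffOn ℝ 2 yref (Ici 0)) (hw₁ : ContDiffOn ℝ 2 w₁ (Ici 0))
    (hw₂ : ContDiffOn ℝ 2 w₂ (Ici 0)) (hw₃ : ContDiffOn ℝ 2 w₃ (Ici 0)) {x₀ : Z} {xc₀ : Cn n}
    (h₂ : S.𝔅 x₀ = (K.δ_c : ℂ) • K.B_c.adjoint xc₀ + w₂ 0) (h₃ : S.𝔅_d x₀ = w₃ 0) :
    ∃ (x : ℝ → Z) (xc : ℝ → Cn n), x 0 = x₀ ∧ xc 0 = xc₀ ∧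
      ContinuousOn x (Ici 0) ∧ ContinuousOn xc (Ici 0) ∧
      S.IsClosedLoopState K yref w₁ w₂ w₃ x xc := by
  obtain ⟨r, r', r'', hr, hr', -, hrf⟩ := exists_extension_of_contDiffOn_two hyref
  obtain ⟨a, a', a'', ha, ha', -, haf⟩ := exists_extension_of_contDiffOn_two hw₁
  obtain ⟨b, b', b'', hb, hb', hb'', hbf⟩ := exists_extension_of_contDiffOn_two hw₂
  obtain ⟨d, d', d'', hd, hd', hd'', hdf⟩ := exists_extension_of_contDiffOn_two hw₃
  have hac : Continuous a' := continuous_iff_continuousAt.2 fun t => (ha' t).continuousAt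
  have hrc : Continuous r' := continuous_iff_continuousAt.2 fun t => (hr' t).continuousAt
  obtain ⟨G, hG⟩ := hS.exists_lift K
  have hinj : ∀ z, S.𝔅e K z = 0 → S.ιe n z = S.𝔄e K z → z = 0 := by
    intro z hz h
    have h1 := hS.dissipative hJ hz
    rw [← h] at h1
    have h2 : (inner ℂ (S.ιe n z) (S.ιe n z)).re = ‖S.ιe n z‖ * ‖S.ιe n z‖ :=
      inner_self_eq_norm_mul_norm (𝕜 := ℂ) (S.ιe n z)
    have h3 : S.ιe n z = 0 := norm_eq_zero.1 (by nlinarith [norm_nonneg (S.ιe n z)])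
    exact S.ιe_injective n (by rw [h3, map_zero])
  -- $(w_2,w_3)$ are the boundary data; $w_1$ and $y_{ref}$ enter as a distributed inhomogeneity.
  obtain ⟨ξ, hξ0, hξc, hξb, hξd⟩ := exists_classical_state (S.ιe n) (S.ιe_injective n) (S.𝔄e K)
    (S.𝔅e K) G hG (hS.generates_closedLoop hJ) hinj
    (w := fun t => (b t, d t)) (w' := fun t => (b' t, d' t)) (w'' := fun t => (b'' t, d'' t))
    (fun t => (hb t).prodMk (hd t)) (fun t => (hb' t).prodMk (hd' t)) (hb''.prodMk hd'')
    (f := fun t => S.inputE K (a t, r t)) (f' := fun t => S.inputE K (a' t, r' t))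
    (fun t => hasDerivAt_clm_comp (S.inputE K) ((ha t).prodMk (hr t)))
    ((S.inputE K).continuous.comp (hac.prodMk hrc)) (WithLp.toLp 2 (x₀, xc₀)) (by
      rw [𝔅e_apply, hbf 0 le_rfl, hdf 0 le_rfl]
      change (S.𝔅 x₀ - (K.δ_c : ℂ) • K.B_c.adjoint xc₀, S.𝔅_d x₀) = _
      rw [h₂, h₃, add_sub_cancel_left])
  let π₁ : WithLp 2 (X × Cn n) →L[ℂ] X := ContinuousLinearMap.fst ℂ X (Cn n) ∘L
    (WithLp.prodContinuousLinearEquiv 2 ℂ X (Cn n) : WithLp 2 (X × Cn n) →L[ℂ] X × Cn n)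
  let π₂ : WithLp 2 (X × Cn n) →L[ℂ] Cn n := ContinuousLinearMap.snd ℂ X (Cn n) ∘L
    (WithLp.prodContinuousLinearEquiv 2 ℂ X (Cn n) : WithLp 2 (X × Cn n) →L[ℂ] X × Cn n)
  have hofLp : Continuous (WithLp.ofLp : WithLp 2 (Z × Cn n) → Z × Cn n) :=
    (WithLp.prodContinuousLinearEquiv 2 ℂ Z (Cn n)).continuous
  refine ⟨fun t => (ξ t).fst, fun t => (ξ t).snd, ?_, ?_,
    (continuous_fst.comp hofLp).comp_continuousOn hξc,
    (continuous_snd.comp hofLp).comp_continuousOn hξc, ⟨?_, ?_, ?_, ?_⟩⟩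
  · exact congrArg WithLp.fst hξ0
  · exact congrArg WithLp.snd hξ0
  · intro t ht
    rw [← haf t ht]
    exact hasDerivWithinAt_clm_comp π₁ (hξd t ht)
  · intro t ht
    have h := hasDerivWithinAt_clm_comp π₂ (hξd t ht)
    refine h.congr_deriv ?_
    change -((K.δ_c : ℂ) • K.B_c (S.ℭ (ξ t).fst)) + K.J_c (ξ t).snd + (K.δ_c : ℂ) • K.B_c (r t) = _
    rw [← hrf t ht, map_sub, smul_sub]
    abel
  · intro t ht
    have h := congrArg Prod.fst (hξb t ht)
    rw [𝔅e_apply] at h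
    rw [← hbf t ht]
    exact (sub_eq_iff_eq_add'.1 h)
  · intro t ht
    rw [← hdf t ht]
    exact congrArg Prod.snd (hξb t ht)

end BCSystem

end BoundaryControl

/-! ### Generation and regularity of closed-loop solutions -/

theorem mainTheorem4 {X Z : Type*}
    [NormedAddCommGroup X] [InnerProductSpace ℂ X] [CompleteSpace X]
    [NormedAddCommGroup Z] [InnerProductSpace ℂ Z] [CompleteSpace Z]
    {p n₁ n₃ n : ℕ}
    (S : BoundaryControl.BCSystem X Z p n₁ n₃) (hS : S.StandingAssumption)
    (K : BoundaryControl.Controller n p) (hJ : K.J_c.adjoint = -K.J_c) (hδ : 0 < K.δ_c) :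
    BoundaryControl.GeneratesContractionSemigroup (S.Ae K) ∧
    ∀ (yref : ℝ → BoundaryControl.Cn p) (w₁ : ℝ → BoundaryControl.Cn n₁)
      (w₂ : ℝ → BoundaryControl.Cn p) (w₃ : ℝ → BoundaryControl.Cn n₃),
      ContDiffOn ℝ 2 yref (Ici 0) → ContDiffOn ℝ 2 w₁ (Ici 0) →
      ContDiffOn ℝ 2 w₂ (Ici 0) → ContDiffOn ℝ 2 w₃ (Ici 0) →
      ∀ (x₀ : Z) (xc₀ : BoundaryControl.Cn n),
        S.𝔅 x₀ = (K.δ_c : ℂ) • K.B_c.adjoint xc₀ + w₂ 0 →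
        S.𝔅_d x₀ = w₃ 0 →
        ∃ (x : ℝ → Z) (xc : ℝ → BoundaryControl.Cn n),
          x 0 = x₀ ∧ xc 0 = xc₀ ∧
          S.IsClosedLoopState K yref w₁ w₂ w₃ x xc ∧
          ∀ T : ℝ, 0 < T →
            ContinuousOn x (Icc 0 T) ∧
            ContDiffOn ℝ 1 (fun t => S.ι (x t)) (Icc 0 T) ∧
            ContDiffOn ℝ 1 xc (Icc 0 T) ∧
            ContinuousOn (fun t => S.ℭ (x t) - yref t) (Icc 0 T) := by
  refine ⟨hS.generates_closedLoop hJ, fun yref w₁ w₂ w₃ hyref hw₁ hw₂ hw₃ x₀ xc₀ h₂ h₃ => ?_⟩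
  obtain ⟨x, xc, hx0, hxc0, hx, hxc, hstate⟩ :=
    hS.exists_closedLoopState hJ hyref hw₁ hw₂ hw₃ h₂ h₃
  have hy : ContinuousOn (fun t => S.ℭ (x t)) (Ici 0) := S.ℭ.continuous.comp_continuousOn hx
  have hr := hyref.continuousOn
  have hw := hw₁.continuousOn
  refine ⟨x, xc, hx0, hxc0, hstate, fun T hT => ⟨hx.mono Icc_subset_Ici_self,
    BoundaryControl.contDiffOn_one_Icc hstate.plant ?_ hT,
    BoundaryControl.contDiffOn_one_Icc hstate.controller ?_ hT,
    (hy.sub hr).mono Icc_subset_Ici_self⟩⟩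
  -- Continuity of `x` in `Z` makes the right-hand sides of both differential equations continuous,
  -- hence the states $C^1$.
  · exact (S.𝔄₀.continuous.comp_continuousOn hx).add (S.B_d.continuous.comp_continuousOn hw)
  · exact (K.J_c.continuous.comp_continuousOn hxc).add
      (((K.δ_c : ℂ) • K.B_c).continuous.comp_continuousOn (hr.sub hy))
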